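/- Let $Q$ be a Dynkin quiver (a finite quiver whose underlying graph is a disjoint union of diagrams of type $A_n,D_n,E_6,E_7,E_8$) with vertex set $\mathbb I$, and let $\varrho$ be an involution of $Q$, i.e. an automorphism of $Q$ with $\varrho^2=\mathrm{Id}$ (possibly the identity). Let $\langle x,y\rangle_Q=\sum_i x_iy_i-\sum_{a:i\to j}x_iy_j$ be the Euler form on $\mathbb Z^{\mathbb I}$, $(x,y)_Q=\langle x,y\rangle_Q+\langle y,x\rangle_Q$, let $\Phi^+\subset\mathbb Z^{\mathbb I}$ be the set of positive roots and $\mathfrak P$ the set of functions $\Phi^+\to\mathbb N$. For a finite field $\mathbf k=\mathbb F_q$ and $\beta\in\Phi^+$ let $M_q(\beta)$ be the indecomposable $\mathbf kQ$-module of dimension vector $\beta$, and for $\lambda\in\mathfrak P$ put $M_q(\lambda)=\bigoplus_{\beta}M_q(\beta)^{\oplus\lambda(\beta)}$, with dimension vector $d^\lambda=(d^\lambda_i)_{i}$. Let $a_\lambda(v)\in\mathbb Z[v,v^{-1}]$ be the automorphism polynomial, i.e. the Laurent polynomial with $|\mathrm{Aut}(M_q(\lambda))|=a_\lambda(\sqrt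 q)$ for every finite field $\mathbb F_q$. Put $\{\lambda,\mu\}=\dim_{\mathbf k}\mathrm{Hom}(M_q(\lambda),M_q(\mu))+\dim_{\mathbf k}\mathrm{Hom}(M_q(\mu),M_q(\lambda))$. Let $\mathcal F\subseteq\mathfrak P$ be the set of $\lambda$ with $\lambda(\varrho\beta)=\lambda(\beta)$ for all $\beta\in\Phi^+$ and $2\mid\lambda(\beta)$ whenever $\varrho\beta=\beta$. For $\lambda\in\mathcal F$ define $\lambda_f,\lambda_c\in\mathfrak P$ by $\lambda_f(\beta)=\lambda(\beta)/2$, $\lambda_c(\beta)=0$ if $\varrho\beta=\beta$, and $\lambda_f(\beta)=0$, $\lambda_c(\beta)=\lambda(\beta)$ otherwise, and let $b_{\lambda_c}(v)\in\mathbb Z[v,v^{-1}]$ be the square root of $a_{\lambda_c}(v)$ that is positive at $v=\sqrt q$ for every finite field $\mathbb F_q$. Let $\mathbb I_0$ be the set of vertices fixed by $\varrho$. Let $\widetilde{\mathbf B}(Q)$ be the $\mathbb Q(v^{1/2})$-vector space with Hall basis $\{\mathfrak u_\lambda\cdot\mathbb K_{\beta^\diamond}\mid\lambda\in\mathfrak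 P,\ \beta\in\mathbb Z^{\mathbb I}\}$ (the underlying space of the extended generic Hall algebra, in which $\mathbb K_{\alpha^\diamond}\cdot\mathfrak u_\mu=v^{(\alpha,d^\mu)_Q}\,\mathfrak u_\mu\cdot\mathbb K_{\alpha^\diamond}$). Put $\mathcal Z=\mathbb Z[v^{1/2},v^{-1/2}]$ and let $\widetilde{\mathbf B}(Q)_{\mathcal Z}$ be the $\mathcal Z$-submodule spanned by all $\mathbb K_{\alpha^\diamond}\cdot\mathfrak u_\mu$ with $\alpha\in\mathbb Z^{\mathbb I}$, $\mu\in\mathfrak P$. Let $\chi:\widetilde{\mathbf B}(Q)\to\mathbb Q(v^{1/2})$ be the linear map with $$\chi(\mathfrak u_\lambda\cdot\mathbb K_{\beta^\diamond})=\chi(\mathfrak u_\lambda)\,\chi(\mathbb K_{\beta^\diamond}),\qquad \chi(\mathbb K_{\beta^\diamond})=v^{\langle\beta,\varrho\beta\rangle_Q+\sum_{i\in\mathbb I_0}\beta_i},$$ $$\chi(\mathfrak u_\lambda)=v^{\frac12\sum_{i\in\mathbb I_0}d^\lambda_i+2\{\lambda_f,\lambda_c\}}\,\frac{a_{2\lambda_f}(v)}{a_{\lambda_f}(v^2)}\,b_{\lambda_c}(v)\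 \text{ if }\lambda\in\mathcal F,\qquad \chi(\mathfrak u_\lambda)=0\ \text{ otherwise.}$$ Then $a_\lambda(v^2)$ divides $a_{2\lambda}(v)$ in $\mathbb Z[v,v^{-1}]$ for every $\lambda\in\mathfrak P$, and $\chi\big(\widetilde{\mathbf B}(Q)_{\mathcal Z}\big)\subseteq\mathcal Z$. -/

import Mathlib

open CategoryTheory CategoryTheory.Limits

noncomputable section

namespace IHall

/-! ### Dynkin quivers, the Euler form, positive roots -/

section Quivers

variable (I : Type) [Fintype I] [DecidableEq I] [Quiver.{0} I]

/-- The Euler form of `mod(kQ)` on the Grothendieck group `ℤ^I`: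
`⟨x, y⟩_Q = ∑_i x_i y_i - ∑_{a : i → j} x_i y_j`. -/
def eulerForm (x y : I → ℤ) : ℤ :=
  ∑ i, x i * y i - ∑ i, ∑ j, (Nat.card (i ⟶ j) : ℤ) * x i * y j

/-- The symmetrised Euler form `(x, y)_Q = ⟨x, y⟩_Q + ⟨y, x⟩_Q`. -/
def symForm (x y : I → ℤ) : ℤ := eulerForm I x y + eulerForm I y x

/-- The simple root `α_i`, that is the class of the simple module `S_i`. -/
def simpleRoot (i : I) : I → ℤ := Pi.single i 1

/-- The Cartan matrix `c_ij = (α_i, α_j)_Q`; it has `2` minus twice the number of loops on the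
diagonal and minus the number of edges between `i` and `j` off the diagonal. -/
def cartanMatrix : Matrix I I ℤ :=
  Matrix.of fun i j => symForm I (simpleRoot I i) (simpleRoot I j)

/-- `Q` is a Dynkin quiver: it has finitely many arrows and its (symmetric) Cartan matrix is of
finite type, i.e. positive definite.  This forbids loops and multiple edges, and says that the
underlying graph is a disjoint union of simply laced Dynkin diagrams `A_n`, `D_n`, `E_6`, `E_7`,
`E_8`. -/
structure IsDynkin : Prop where
  finite_arrows : ∀ i j : I, Finite (i ⟶ j)
  posDef : (cartanMatrix I).PosDef

/-- The roots: the smallest set of vectors of `ℤ^I` that contains the simple roots and is stable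
under the simple reflections `s_i(β) = β - (β, α_i) α_i`. -/
inductive IsRoot : (I → ℤ) → Prop
  | simple (i : I) : IsRoot (simpleRoot I i)
  | reflect (i : I) (β : I → ℤ) :
      IsRoot β → IsRoot (β - symForm I β (simpleRoot I i) • simpleRoot I i)

/-- The set `Φ⁺` of positive roots. -/
abbrev PosRoot : Type := {β : I → ℤ // IsRoot I β ∧ ∀ i, 0 ≤ β i}

/-- The set `𝔓` of functions `Φ⁺ → ℕ`.  For a Dynkin quiver `Φ⁺` is finite, so that every function
on it is finitely supported. -/
abbrev RootFun : Type := PosRoot I →₀ ℕ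

variable {I}

/-- The dimension vector `d^lam = ∑_β lam(β) β` of the module `M_q(lam)`. -/
def dimVec (lam : RootFun I) : I → ℤ := lam.sum fun β n => (n : ℤ) • β.1

end Quivers

/-! ### Representations over a field, automorphism polynomials -/

section Representations

variable {I : Type} [Fintype I] [DecidableEq I] [Quiver.{0} I]

/-- The category `mod(kQ)` of finite dimensional representations of the quiver over `k`: functors
from the free category on `Q` to finite dimensional vector spaces. -/
abbrev QRep (I : Type) [Quiver.{0} I] (k : Type) [Field k] : Type 1 :=
  Paths I ⥤ FGModuleCat.{0} k

/-- `X` is an indecomposable representation of dimension vector `β`. -/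
def IsIndecOfDim (k : Type) [Field k] (β : I → ℤ) (X : QRep I k) : Prop :=
  Indecomposable X ∧
    ∀ i : I, (Module.finrank k (X.obj ((Paths.of I).obj i)) : ℤ) = β i

instance nonempty_qRep (I : Type) [Quiver.{0} I] (k : Type) [Field k] : Nonempty (QRep I k) :=
  ⟨(Functor.const (Paths I)).obj (FGModuleCat.of k k)⟩

instance hasFiniteBiproducts_qRep (I : Type) [Quiver.{0} I] (k : Type) [Field k] :
    HasFiniteBiproducts (QRep I k) :=
  Abelian.hasFiniteBiproducts

/-- `M_q(β)`: the indecomposable module of dimension vector `β ∈ Φ⁺` (it exists and is unique up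
to isomorphism by Gabriel's theorem). -/
def indecRep (k : Type) [Field k] (β : PosRoot I) : QRep I k :=
  Classical.epsilon (IsIndecOfDim k β.1)

/-- `M_q(lam) = ⨁_β M_q(β)^{lam(β)}`. -/
def partRep (k : Type) [Field k] (lam : RootFun I) : QRep I k :=
  ⨁ fun p : (Σ β : lam.support, Fin (lam β.1)) => indecRep k p.1.1

/-- Evaluation of a Laurent polynomial with integer coefficients at a unit of a ring. -/
def evalAt {S : Type*} [CommRing S] (x : Sˣ) : LaurentPolynomial ℤ →+* S :=
  LaurentPolynomial.eval₂ (Int.castRingHom S) x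

/-- The unit `√q` of `ℝ`, for `q` the number of elements of a finite field. -/
def sqrtCard (k : Type) [Field k] [Finite k] : ℝˣ :=
  Units.mk0 (Real.sqrt (Nat.card k)) (by
    have : 0 < Nat.card k := Nat.card_pos
    positivity)

/-- `a ∈ ℤ[v, v⁻¹]` satisfies `|Aut M_q(lam)| = a(√q)` for all finite fields. -/
def IsAutPoly (lam : RootFun I) (a : LaurentPolynomial ℤ) : Prop :=
  ∀ (k : Type) [Field k] [Finite k],
    (Nat.card (Aut (partRep k lam)) : ℝ) = evalAt (sqrtCard k) a

open Classical in
/-- The automorphism polynomial `a_lam(v)`: the (unique) Laurent polynomial with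
`a_lam(√q) = |Aut M_q(lam)|` for all finite fields `𝔽_q`; it exists by a theorem of Ringel. -/
def autPoly (lam : RootFun I) : LaurentPolynomial ℤ :=
  if h : ∃ a, IsAutPoly lam a then h.choose else 0

/-- `b ∈ ℤ[v, v⁻¹]` is the square root of `a_lam(v)` that is positive at all `v = √q`. -/
def IsSqrtAutPoly (lam : RootFun I) (b : LaurentPolynomial ℤ) : Prop :=
  b ^ 2 = autPoly lam ∧
    ∀ (k : Type) [Field k] [Finite k], 0 < evalAt (sqrtCard k) b

open Classical in
/-- The square root `b_lam(v)` of `a_lam(v)`; it exists if `lam` is invariant under the involution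
of the quiver and supported on roots that are not. -/
def sqrtAutPoly (lam : RootFun I) : LaurentPolynomial ℤ :=
  if h : ∃ b, IsSqrtAutPoly lam b then h.choose else 0

/-- The substitution `v ↦ v²` on `ℤ[v, v⁻¹]`. -/
def substSq : LaurentPolynomial ℤ →+* LaurentPolynomial ℤ :=
  evalAt (LaurentPolynomial.isUnit_T (R := ℤ) 2).unit

/-- `{lam, mu} = dim_k Hom(M_q(lam), M_q(mu)) + dim_k Hom(M_q(mu), M_q(lam))`. -/
def homSum (k : Type) [Field k] (lam mu : RootFun I) : ℕ :=
  Module.finrank k (partRep k lam ⟶ partRep k mu) +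
    Module.finrank k (partRep k mu ⟶ partRep k lam)

end Representations

/-! ### The Borel part of the Hall algebra and its integral form -/

section Borel

variable (I : Type) [Fintype I] [DecidableEq I] [Quiver.{0} I]

/-- The field `ℚ(v^{1/2})`; its variable `RatFunc.X` is `v^{1/2}`. -/
abbrev Kv : Type := RatFunc ℚ

/-- `v^{1/2}` as an element of `ℚ(v^{1/2})`. -/
def vHalf : Kv := RatFunc.X

/-- `v` as an element of `ℚ(v^{1/2})`. -/
def vv : Kv := vHalf ^ 2

/-- `v` as a unit. -/
def vUnit : Kvˣ := Units.mk0 vv (pow_ne_zero 2 RatFunc.X_ne_zero)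

/-- The ring `𝒵 = ℤ[v^{1/2}, v^{-1/2}]`. -/
def ZZv : Subalgebra ℤ Kv := Algebra.adjoin ℤ {vHalf, vHalf⁻¹}

/-- The `ℚ(v^{1/2})`-vector space `B̃(Q)`, given by its Hall basis
`{u_lam · K_{α^⋄} | lam ∈ 𝔓, α ∈ ℤ^I}`. -/
abbrev BTilde : Type := (RootFun I × (I → ℤ)) →₀ Kv

variable {I}

/-- The Hall basis element `u_lam · K_{α^⋄}`. -/
def uK (lam : RootFun I) (α : I → ℤ) : BTilde I := Finsupp.single (lam, α) 1

/-- The product in the other order, `K_{α^⋄} * u_mu = v^{(α, mu)_Q} u_mu · K_{α^⋄}`. -/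
def Ku (α : I → ℤ) (mu : RootFun I) : BTilde I :=
  vv ^ symForm I α (dimVec mu) • uK mu α

variable (I)

/-- The integral form `B̃(Q)_𝒵`: the `𝒵`-span of the elements `K_{α^⋄} * u_mu`. -/
def integralForm : Submodule ZZv (BTilde I) :=
  Submodule.span ZZv {x | ∃ (α : I → ℤ) (mu : RootFun I), x = Ku α mu}

end Borel

/-! ### The involution and the linear map `χ` -/

section Involution

variable {I : Type} [Quiver.{0} I]

theorem rho_obj_obj {rho : I ⥤q I} (h : rho ⋙q rho = 𝟭q I) (i : I) :
    rho.obj (rho.obj i) = i :=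
  Prefunctor.congr_obj h i

theorem card_hom_rho {rho : I ⥤q I} (h : rho ⋙q rho = 𝟭q I) (i j : I) :
    Nat.card (rho.obj i ⟶ rho.obj j) = Nat.card (i ⟶ j) := by
  have inj : Function.Injective (fun f : i ⟶ j => rho.map f) := by
    intro f g hfg
    have hf := Prefunctor.congr_hom h f
    have hg := Prefunctor.congr_hom h g
    have e : (rho ⋙q rho).map f = (rho ⋙q rho).map g := congrArg (fun t => rho.map t) hfg
    rw [e] at hf
    exact hf.symm.trans hg
  have surj : Function.Surjective (fun f : i ⟶ j => rho.map f) := fun g =>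
    ⟨Quiver.homOfEq (rho.map g) (Prefunctor.congr_obj h i) (Prefunctor.congr_obj h j),
      (Prefunctor.homOfEq_map rho _ _ _).trans (Prefunctor.congr_hom h g)⟩
  exact (Nat.card_congr (Equiv.ofBijective _ ⟨inj, surj⟩)).symm

/-- The action of an involution `ϱ` of the quiver on `ℤ^I`, with `ϱ(α_i) = α_{ϱ i}`: the `i`-th
coordinate of `ϱ(β)` is the `ϱ(i)`-th coordinate of `β`, because `ϱ` is its own inverse. -/
def rhoVec (rho : I ⥤q I) (β : I → ℤ) : I → ℤ := fun i => β (rho.obj i)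

theorem rhoVec_simpleRoot [DecidableEq I] {rho : I ⥤q I} (h : rho ⋙q rho = 𝟭q I) (i : I) :
    rhoVec rho (simpleRoot I i) = simpleRoot I (rho.obj i) := by
  funext j
  have : rho.obj j = i ↔ j = rho.obj i :=
    ⟨fun e => by rw [← e, rho_obj_obj h], fun e => by rw [e, rho_obj_obj h]⟩
  simp [rhoVec, simpleRoot, Pi.single_apply, this]

theorem eulerForm_rhoVec [Fintype I] {rho : I ⥤q I} (h : rho ⋙q rho = 𝟭q I) (x y : I → ℤ) :
    eulerForm I (rhoVec rho x) (rhoVec rho y) = eulerForm I x y := by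
  let e : I ≃ I := ⟨rho.obj, rho.obj, rho_obj_obj h, rho_obj_obj h⟩
  unfold eulerForm
  congr 1
  · exact Equiv.sum_comp e fun i => x i * y i
  · rw [← Equiv.sum_comp e fun i => ∑ j, (Nat.card (i ⟶ j) : ℤ) * x i * y j]
    refine Finset.sum_congr rfl fun i _ => ?_
    rw [← Equiv.sum_comp e fun j => (Nat.card (e i ⟶ j) : ℤ) * x (e i) * y j]
    refine Finset.sum_congr rfl fun j _ => ?_
    rw [show Nat.card (e i ⟶ e j) = Nat.card (i ⟶ j) from card_hom_rho h i j]
    rfl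

theorem isRoot_rhoVec [Fintype I] [DecidableEq I] {rho : I ⥤q I} (h : rho ⋙q rho = 𝟭q I)
    {β : I → ℤ} (hβ : IsRoot I β) : IsRoot I (rhoVec rho β) := by
  induction hβ with
  | simple i => rw [rhoVec_simpleRoot h]; exact IsRoot.simple _
  | reflect i β _ ih =>
    have := IsRoot.reflect (rho.obj i) _ ih
    rw [← rhoVec_simpleRoot h i, symForm, eulerForm_rhoVec h, eulerForm_rhoVec h] at this
    exact this

/-- An involution of the quiver `Q`: an automorphism `ϱ` of `Q` with `ϱ² = Id` (the identity is
allowed). -/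
structure QuiverInvolution (I : Type) [Quiver.{0} I] where
  toPrefunctor : I ⥤q I
  comp_self : toPrefunctor ⋙q toPrefunctor = 𝟭q I

end Involution

section Chi

variable {I : Type} [Fintype I] [DecidableEq I] [Quiver.{0} I] (rho : QuiverInvolution I)

/-- The action of the involution on `Φ⁺`. -/
def rhoRoot (β : PosRoot I) : PosRoot I :=
  ⟨rhoVec rho.toPrefunctor β.1, isRoot_rhoVec rho.comp_self β.2.1, fun _ => β.2.2 _⟩

/-- The subset `𝓕 ⊆ 𝔓` of the `ϱ`-invariant functions that take even values on the roots fixed by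
`ϱ`. -/
def IsF (lam : RootFun I) : Prop :=
  (∀ β, lam (rhoRoot rho β) = lam β) ∧ ∀ β, rhoRoot rho β = β → 2 ∣ lam β

open Classical in
/-- `lam_f`, equal to `lam(β) / 2` at the roots `β` fixed by `ϱ` and to `0` at the others. -/
def lamF (lam : RootFun I) : RootFun I :=
  (lam.filter fun β => rhoRoot rho β = β).mapRange (fun n => n / 2) (Nat.zero_div 2)

open Classical in
/-- `lam_c`, equal to `lam(β)` at the roots `β` not fixed by `ϱ` and to `0` at the others. -/
def lamC (lam : RootFun I) : RootFun I :=
  lam.filter fun β => rhoRoot rho β ≠ β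

/-- `∑_{i ∈ I_0} d_i`, where `I_0` is the set of vertices fixed by `ϱ`. -/
def fixedSum (d : I → ℤ) : ℤ :=
  ∑ i with rho.toPrefunctor.obj i = i, d i

/-- `χ(K_{β^⋄}) = v^{⟨β, ϱ(β)⟩_Q + ∑_{i ∈ I_0} β_i}`. -/
def chiK (β : I → ℤ) : Kv :=
  vv ^ (eulerForm I β (rhoVec rho.toPrefunctor β) + fixedSum rho β)

open Classical in
/-- `χ(u_lam) = v^{(1/2) ∑_{i ∈ I_0} d_i^lam + 2 {lam_f, lam_c}} · a_{2 lam_f}(v) / a_{lam_f}(v²) ·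
b_{lam_c}(v)` for `lam ∈ 𝓕`, and `0` otherwise. -/
def chiU (k : Type) [Field k] (lam : RootFun I) : Kv :=
  if IsF rho lam then
    vHalf ^ fixedSum rho (dimVec lam) * vv ^ (2 * homSum k (lamF rho lam) (lamC rho lam)) *
      (evalAt vUnit (autPoly (2 • lamF rho lam)) /
        evalAt vUnit (substSq (autPoly (lamF rho lam)))) *
      evalAt vUnit (sqrtAutPoly (lamC rho lam))
  else 0

/-- The linear map `χ : B̃(Q) → ℚ(v^{1/2})` with `χ(u_lam · K_{β^⋄}) = χ(u_lam) χ(K_{β^⋄})`. -/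
def chi (k : Type) [Field k] : BTilde I →ₗ[Kv] Kv :=
  Finsupp.linearCombination Kv fun p : RootFun I × (I → ℤ) => chiU rho k p.1 * chiK rho p.2

end Chi

end IHall

end

/-!
Everything rests on an explicit formula for the automorphism polynomials. Over a finite field `k`
with `q` elements, `End(M_q(lam))` maps onto `∏_β Mat_{lam(β)}(k)` with kernel in the radical,
because the `M_q(β)` are pairwise non-isomorphic and have endomorphism algebra `k`. Hence
`|Aut M_q(lam)| = q^r ∏_β |GL_{lam(β)}(𝔽_q)|` (`card_aut_isotypicSum`), where `r` is determined by the
dimensions of the spaces `Hom(M_q(β), M_q(γ))`. These are `max(0, ⟨β, γ⟩_Q)`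
(`finrank_hom_of_indecomposable`), so that `r` does not depend on `q` and the right hand side is a
Laurent polynomial in `v = √q`, which is `a_lam` (`autPoly_eq`). The factors `v^{4n} - v^{4i}` of
`|GL_n|` at `v²` are among the factors `v^{4n} - v^{2i}` of `|GL_{2n}|` at `v`, and powers
of `v` are units; this is the divisibility. It makes the quotient in `χ(u_lam)` a Laurent
polynomial in `v`, and the other factors of `χ(u_lam)` and `χ(K_{β^⋄})` lie in `𝒵` by inspection.

The facts about representations are those of Gabriel's theorem, and they are derived for any field
from the positivity of the Euler form. `Hom(X, Y)` and `Ext¹(X, Y)` are the cohomology of the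
two-term complex `∏_i Hom(X_i, Y_i) → ∏_{i → j} Hom(X_i, Y_j)`; its Euler characteristic is
`⟨dim X, dim Y⟩`, and `Ext¹` is right exact.
* An indecomposable representation is a brick without self-extensions
  (`isBrick_of_indecomposable`, `IsBrick.extZero`): a self-extension of a brick contradicts
  positivity, and the summands of the kernel of a suitable endomorphism of an indecomposable
  non-brick would split off.
* If `X` and `Y` are indecomposable, then `Hom(X, Y) = 0` or `Ext¹(X, Y) = 0`
  (`hom_eq_zero_or_extZero`), by the lemma of Happel and Ringel (`mono_or_epi_of_extZero`) and a
  universal extension (`extZero_or_extZero`). This gives the dimension of `Hom(X, Y)`.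
* For a root `β`, a representation of dimension vector `β` with the smallest endomorphism algebra
  is indecomposable (`exists_indecomposable`).
-/

noncomputable section

namespace IHall

/-! ### Fibres of a representation -/

section Fibres

variable {I : Type} [Quiver.{0} I] {k : Type} [Field k]

/-- The exact functor that sends a representation to its vector space at the vertex `i`. -/
abbrev fiber (k : Type) [Field k] (i : I) : QRep I k ⥤ ModuleCat.{0} k :=
  (evaluation (Paths I) (FGModuleCat k)).obj ((Paths.of I).obj i) ⋙ forget₂ _ _

/-- The vector space of `X` at the vertex `i`. -/
abbrev sp (X : QRep I k) (i : I) : Type := (fiber k i).obj X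

/-- The linear map at the vertex `i` of a morphism of representations. -/
abbrev lin {X Y : QRep I k} (f : X ⟶ Y) (i : I) : sp X i →ₗ[k] sp Y i := ((fiber k i).map f).hom

/-- The linear map of `X` at an arrow. -/
def ar (X : QRep I k) {i j : I} (a : i ⟶ j) : sp X i →ₗ[k] sp X j :=
  (X.map ((Paths.of I).map a)).hom.hom

instance finite_sp (X : QRep I k) (i : I) : Module.Finite k (sp X i) :=
  (X.obj ((Paths.of I).obj i)).property

theorem lin_injective {X Y : QRep I k} (f : X ⟶ Y) [Mono f] (i : I) :
    Function.Injective (lin f i) :=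
  (ModuleCat.mono_iff_injective _).1 inferInstance

theorem lin_surjective {X Y : QRep I k} (f : X ⟶ Y) [Epi f] (i : I) :
    Function.Surjective (lin f i) :=
  (ModuleCat.epi_iff_surjective _).1 inferInstance

@[simp] theorem lin_id (X : QRep I k) (i : I) : lin (𝟙 X) i = LinearMap.id := rfl

theorem lin_comp {X Y Z : QRep I k} (f : X ⟶ Y) (g : Y ⟶ Z) (i : I) :
    lin (f ≫ g) i = lin g i ∘ₗ lin f i := rfl

theorem lin_add {X Y : QRep I k} (f g : X ⟶ Y) (i : I) : lin (f + g) i = lin f i + lin g i := rfl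

theorem lin_zero (X Y : QRep I k) (i : I) : lin (0 : X ⟶ Y) i = 0 := rfl

theorem lin_naturality {X Y : QRep I k} (f : X ⟶ Y) {i j : I} (a : i ⟶ j) :
    lin f j ∘ₗ ar X a = ar Y a ∘ₗ lin f i := by
  have := f.naturality ((Paths.of I).map a)
  exact congrArg (fun g => g.hom.hom) this

theorem hom_ext_lin {X Y : QRep I k} {f g : X ⟶ Y} (h : ∀ i, lin f i = lin g i) : f = g := by
  apply NatTrans.ext
  funext i
  exact FGModuleCat.hom_ext (h i)

/-- A family of linear maps that commutes with the arrows is a morphism of representations. -/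
def homMk {X Y : QRep I k} (f : ∀ i, sp X i →ₗ[k] sp Y i)
    (h : ∀ (i j : I) (a : i ⟶ j), f j ∘ₗ ar X a = ar Y a ∘ₗ f i) : X ⟶ Y :=
  Paths.liftNatTrans (F := X) (G := Y)
    (fun i => ConcreteCategory.ofHom (C := FGModuleCat k) (f i))
    (fun {i j} a => FGModuleCat.hom_ext (h i j a))

/-- The representation with given vector spaces and linear maps. -/
def repMk (V : I → Type) [∀ i, AddCommGroup (V i)] [∀ i, Module k (V i)]
    [∀ i, Module.Finite k (V i)] (f : ∀ {i j : I}, (i ⟶ j) → (V i →ₗ[k] V j)) : QRep I k :=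
  Paths.lift { obj := fun i => FGModuleCat.of k (V i), map := fun a => FGModuleCat.ofHom (f a) }

theorem exact_lin {S : ShortComplex (QRep I k)} (h : S.ShortExact) (i : I) :
    Function.Exact (lin S.f i) (lin S.g i) := by
  have h' := h.exact.map (fiber k i)
  rw [ShortComplex.moduleCat_exact_iff_range_eq_ker] at h'
  exact LinearMap.exact_iff.2 h'.symm

theorem isIso_of_bijective {X Y : QRep I k} (f : X ⟶ Y)
    (h : ∀ i, Function.Bijective (lin f i)) : IsIso f := by
  have key : ∀ j : Paths I, IsIso (f.app j) := fun j => by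
    have : IsIso ((fiber k (I := I) j).map f) := by
      rw [ConcreteCategory.isIso_iff_bijective]
      exact h j
    have : IsIso ((forget₂ (FGModuleCat k) (ModuleCat k)).map (f.app j)) := this
    exact isIso_of_reflects_iso (f.app j) (forget₂ (FGModuleCat k) (ModuleCat k))
  exact NatIso.isIso_of_isIso_app f

end Fibres

/-! ### Cochains -/

section Cochains

variable {I : Type} [Quiver.{0} I] {k : Type} [Field k]

/-- Families of linear maps `X_{s a} → Y_{t a}`, indexed by `a : ι`. -/
abbrev Coch {ι : Type} (s t : ι → I) (X Y : QRep I k) : Type :=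
  ∀ a : ι, sp X (s a) →ₗ[k] sp Y (t a)

/-- The type of all arrows of the quiver. -/
abbrev Arr (I : Type) [Quiver.{0} I] : Type := Σ p : I × I, (p.1 ⟶ p.2)

/-- Families of linear maps `X_i → Y_i`, for the vertices `i`. -/
abbrev Coch0 (X Y : QRep I k) : Type := Coch (fun i : I => i) (fun i : I => i) X Y

/-- Families of linear maps `X_i → Y_j`, for the arrows `i → j`. -/
abbrev Coch1 (X Y : QRep I k) : Type :=
  Coch (fun a : Arr I => a.1.1) (fun a : Arr I => a.1.2) X Y

/-- The differential of the standard two-term complex, whose kernel is `Hom(X, Y)` and whose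
cokernel is `Ext¹(X, Y)`. -/
def diff (X Y : QRep I k) : Coch0 X Y →ₗ[k] Coch1 X Y where
  toFun f a := f a.1.2 ∘ₗ ar X a.2 - ar Y a.2 ∘ₗ f a.1.1
  map_add' f g := by
    funext a
    simp only [Pi.add_apply, LinearMap.add_comp, LinearMap.comp_add]
    abel
  map_smul' c f := by
    funext a
    simp only [Pi.smul_apply, LinearMap.smul_comp, LinearMap.comp_smul, smul_sub,
      RingHom.id_apply]

variable {ι : Type} {s t : ι → I} {X X' X'' Y Y' Y'' : QRep I k}

/-- Composition of a family of linear maps with a morphism on the source side. -/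
def pre (u : X' ⟶ X) : Coch s t X Y →ₗ[k] Coch s t X' Y where
  toFun c a := c a ∘ₗ lin u (s a)
  map_add' _ _ := rfl
  map_smul' _ _ := rfl

/-- Composition of a family of linear maps with a morphism on the target side. -/
def post (w : Y ⟶ Y') : Coch s t X Y →ₗ[k] Coch s t X Y' where
  toFun c a := lin w (t a) ∘ₗ c a
  map_add' c c' := by funext a; exact LinearMap.comp_add _ _ _
  map_smul' r c := by funext a; exact LinearMap.comp_smul _ _ _

theorem diff_pre (u : X' ⟶ X) (f : Coch0 X Y) : diff X' Y (pre u f) = pre u (diff X Y f) := by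
  funext a
  change (f a.1.2 ∘ₗ lin u a.1.2) ∘ₗ ar X' a.2 - ar Y a.2 ∘ₗ f a.1.1 ∘ₗ lin u a.1.1 =
    (f a.1.2 ∘ₗ ar X a.2 - ar Y a.2 ∘ₗ f a.1.1) ∘ₗ lin u a.1.1
  rw [LinearMap.comp_assoc, lin_naturality, LinearMap.sub_comp]
  rfl

theorem diff_post (w : Y ⟶ Y') (f : Coch0 X Y) :
    diff X Y' (post w f) = post w (diff X Y f) := by
  funext a
  change (lin w a.1.2 ∘ₗ f a.1.2) ∘ₗ ar X a.2 - ar Y' a.2 ∘ₗ lin w a.1.1 ∘ₗ f a.1.1 =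
    lin w a.1.2 ∘ₗ (f a.1.2 ∘ₗ ar X a.2 - ar Y a.2 ∘ₗ f a.1.1)
  rw [← LinearMap.comp_assoc, ← lin_naturality, LinearMap.comp_sub]
  rfl

theorem pre_pre (u : X' ⟶ X) (u' : X'' ⟶ X') (c : Coch s t X Y) :
    pre u' (pre u c) = pre (u' ≫ u) c := rfl

theorem post_post (w : Y ⟶ Y') (w' : Y' ⟶ Y'') (c : Coch s t X Y) :
    post w' (post w c) = post (w ≫ w') c := rfl

theorem pre_post (u : X' ⟶ X) (w : Y ⟶ Y') (c : Coch s t X Y) :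
    pre u (post w c) = post w (pre u c) := rfl

@[simp] theorem pre_id (c : Coch s t X Y) : pre (𝟙 X) c = c := rfl

@[simp] theorem post_id (c : Coch s t X Y) : post (𝟙 Y) c = c := rfl

@[simp] theorem pre_zero (c : Coch s t X Y) : pre (0 : X' ⟶ X) c = 0 := by
  funext a; exact LinearMap.comp_zero _

@[simp] theorem post_zero (c : Coch s t X Y) : post (0 : Y ⟶ Y') c = 0 := by
  funext a; exact LinearMap.zero_comp _

theorem post_add (w w' : Y ⟶ Y') (c : Coch s t X Y) :
    post (w + w') c = post w c + post w' c := rfl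

theorem pre_add (u u' : X' ⟶ X) (c : Coch s t X Y) :
    pre (u + u') c = pre u c + pre u' c := by
  funext a; exact LinearMap.comp_add _ _ _

theorem pre_surjective (u : X' ⟶ X) [Mono u] :
    Function.Surjective (pre u : Coch s t X Y →ₗ[k] Coch s t X' Y) := fun c => by
  choose g hg using fun a =>
    (lin u (s a)).exists_leftInverse_of_injective (LinearMap.ker_eq_bot.2 (lin_injective u (s a)))
  refine ⟨fun a => c a ∘ₗ g a, funext fun a => ?_⟩
  change (c a ∘ₗ g a) ∘ₗ lin u (s a) = c a
  rw [LinearMap.comp_assoc, hg, LinearMap.comp_id]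

theorem post_surjective (w : Y ⟶ Y') [Epi w] :
    Function.Surjective (post w : Coch s t X Y →ₗ[k] Coch s t X Y') := fun c => by
  choose g hg using fun a =>
    (lin w (t a)).exists_rightInverse_of_surjective
      (LinearMap.range_eq_top.2 (lin_surjective w (t a)))
  refine ⟨fun a => g a ∘ₗ c a, funext fun a => ?_⟩
  change lin w (t a) ∘ₗ (g a ∘ₗ c a) = c a
  rw [← LinearMap.comp_assoc, hg, LinearMap.id_comp]

theorem post_injective (w : Y ⟶ Y') [Mono w] :
    Function.Injective (post w : Coch s t X Y →ₗ[k] Coch s t X Y') := fun c c' h => by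
  funext a
  exact (LinearMap.cancel_left (lin_injective w (t a))).1 (congrFun h a)

theorem exists_pre_of_pre_eq_zero {S : ShortComplex (QRep I k)} (h : S.ShortExact)
    (c : Coch s t S.X₂ Y) (hc : pre S.f c = 0) : ∃ c' : Coch s t S.X₃ Y, pre S.g c' = c := by
  have := h.epi_g
  choose g hg using fun a => (lin S.g (s a)).exists_rightInverse_of_surjective
    (LinearMap.range_eq_top.2 (lin_surjective S.g (s a)))
  refine ⟨fun a => c a ∘ₗ g a, funext fun a => LinearMap.ext fun x => ?_⟩
  change c a (g a (lin S.g (s a) x)) = c a x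
  have h0 : lin S.g (s a) (g a (lin S.g (s a) x) - x) = 0 := by
    rw [map_sub, sub_eq_zero]
    exact LinearMap.congr_fun (hg a) _
  obtain ⟨y, hy⟩ := (exact_lin h (s a) _).1 h0
  have h1 : c a (lin S.f (s a) y) = 0 := LinearMap.congr_fun (congrFun hc a) y
  rw [hy, map_sub, sub_eq_zero] at h1
  exact h1

theorem exists_post_of_post_eq_zero {S : ShortComplex (QRep I k)} (h : S.ShortExact)
    (c : Coch s t X S.X₂) (hc : post S.g c = 0) : ∃ c' : Coch s t X S.X₁, post S.f c' = c := by
  have := h.mono_f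
  choose g hg using fun a => (lin S.f (t a)).exists_leftInverse_of_injective
    (LinearMap.ker_eq_bot.2 (lin_injective S.f (t a)))
  refine ⟨fun a => g a ∘ₗ c a, funext fun a => LinearMap.ext fun x => ?_⟩
  change lin S.f (t a) (g a (c a x)) = c a x
  have h0 : lin S.g (t a) (c a x) = 0 := LinearMap.congr_fun (congrFun hc a) x
  obtain ⟨y, hy⟩ := (exact_lin h (t a) _).1 h0
  rw [← hy]
  exact congrArg _ (LinearMap.congr_fun (hg a) y)

/-! #### Morphisms as cocycles -/

/-- The family of linear maps underlying a morphism. -/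
def toCoch (f : X ⟶ Y) : Coch0 X Y := fun i => lin f i

theorem toCoch_injective : Function.Injective (toCoch : (X ⟶ Y) → Coch0 X Y) := fun _ _ h =>
  hom_ext_lin fun i => congrFun h i

@[simp] theorem diff_toCoch (f : X ⟶ Y) : diff X Y (toCoch f) = 0 := by
  funext a
  exact sub_eq_zero.2 (lin_naturality f a.2)

theorem exists_toCoch {f : Coch0 X Y} (h : diff X Y f = 0) : ∃ g : X ⟶ Y, toCoch g = f :=
  ⟨homMk f fun i j a => sub_eq_zero.1 (congrFun h ⟨(i, j), a⟩), rfl⟩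

theorem pre_toCoch (u : X' ⟶ X) (f : X ⟶ Y) : pre u (toCoch f) = toCoch (u ≫ f) := rfl

theorem post_toCoch (w : Y ⟶ Y') (f : X ⟶ Y) : post w (toCoch f) = toCoch (f ≫ w) := rfl

theorem toCoch_add (f g : X ⟶ Y) : toCoch (f + g) = toCoch f + toCoch g := rfl

/-- Morphisms are the zero-cocycles. -/
def homEquivKer (X Y : QRep I k) : (X ⟶ Y) ≃ₗ[k] LinearMap.ker (diff X Y) :=
  LinearEquiv.ofBijective
    { toFun := fun f => ⟨toCoch f, diff_toCoch f⟩
      map_add' := fun _ _ => rfl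
      map_smul' := fun _ _ => rfl }
    ⟨fun _ _ h => toCoch_injective (Subtype.ext_iff.1 h),
      fun f => by
        obtain ⟨g, hg⟩ := exists_toCoch f.2
        exact ⟨g, Subtype.ext hg⟩⟩

/-- `Ext¹(X, Y) = 0`. -/
def ExtZero (X Y : QRep I k) : Prop := Function.Surjective (diff X Y)

/-- `Ext¹( , Y)` is right exact, because every family of linear maps on a subobject extends. -/
theorem ExtZero.of_mono (h : ExtZero X Y) (u : X' ⟶ X) [Mono u] : ExtZero X' Y := fun c => by
  obtain ⟨c', rfl⟩ := pre_surjective u c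
  obtain ⟨f, rfl⟩ := h c'
  exact ⟨pre u f, diff_pre u f⟩

/-- `Ext¹(X, )` is right exact, because families of linear maps lift along surjections. -/
theorem ExtZero.of_epi (h : ExtZero X Y) (w : Y ⟶ Y') [Epi w] : ExtZero X Y' := fun c => by
  obtain ⟨c', rfl⟩ := post_surjective w c
  obtain ⟨f, rfl⟩ := h c'
  exact ⟨post w f, diff_post w f⟩

/-- The obstruction to extending a morphism along a subobject lies in `Ext¹` of the quotient. -/
theorem ExtZero.exists_extend {S : ShortComplex (QRep I k)} (h : S.ShortExact)
    (hY : ExtZero S.X₃ Y) (p : S.X₁ ⟶ Y) : ∃ r : S.X₂ ⟶ Y, S.f ≫ r = p := by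
  have := h.mono_f
  have := h.epi_g
  obtain ⟨f, hf⟩ := pre_surjective S.f (toCoch p)
  obtain ⟨c, hc⟩ := exists_pre_of_pre_eq_zero h (diff _ _ f) (by rw [← diff_pre, hf, diff_toCoch])
  obtain ⟨g, rfl⟩ := hY c
  obtain ⟨r, hr⟩ := exists_toCoch (f := f - pre S.g g) (by rw [map_sub, diff_pre, hc, sub_self])
  refine ⟨r, toCoch_injective ?_⟩
  rw [← pre_toCoch, hr, map_sub, hf, pre_pre, S.zero, pre_zero, sub_zero]

/-- `X` is a direct sum of `A` and `B`, given by its projections and inclusions. -/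
theorem extZero_of_decomp_left {A B : QRep I k} (hA : ExtZero A Y) (hB : ExtZero B Y)
    (pA : X ⟶ A) (iA : A ⟶ X) (pB : X ⟶ B) (iB : B ⟶ X) (h : pA ≫ iA + pB ≫ iB = 𝟙 X) :
    ExtZero X Y := fun c => by
  obtain ⟨f, hf⟩ := hA (pre iA c)
  obtain ⟨g, hg⟩ := hB (pre iB c)
  refine ⟨pre pA f + pre pB g, ?_⟩
  rw [map_add, diff_pre, diff_pre, hf, hg, pre_pre, pre_pre, ← pre_add, h, pre_id]

end Cochains

/-! ### Extensions -/

section Extensions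

variable {I : Type} [Quiver.{0} I] {k : Type} [Field k]

/-- An extension `0 → B → E → A → 0` together with splittings `sec` and `ret` of the underlying
families of vector spaces. By `diff_sec`, its class in `Ext¹(A, B)` is that of `c`, up to sign. -/
structure SplitExtension {A B : QRep I k} (c : Coch1 A B) where
  E : QRep I k
  inj : B ⟶ E
  proj : E ⟶ A
  sec : Coch0 A E
  ret : Coch0 E B
  inj_proj : inj ≫ proj = 0
  inj_ret : pre inj ret = toCoch (𝟙 B)
  sec_proj : post proj sec = toCoch (𝟙 A)
  total : post inj ret + pre proj sec = toCoch (𝟙 E)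
  diff_sec : diff A E sec = - post inj c
  finrank_eq : ∀ i,
    Module.finrank k (sp E i) = Module.finrank k (sp B i) + Module.finrank k (sp A i)

/-- The extension with vector spaces `B_i × A_i` and arrows `(b, a) ↦ (B b + c a, A a)`. -/
def splitExtension {A B : QRep I k} (c : Coch1 A B) : SplitExtension c where
  E := repMk (fun i => sp B i × sp A i) fun {i j} a =>
    LinearMap.prod (ar B a ∘ₗ LinearMap.fst k _ _ + c ⟨(i, j), a⟩ ∘ₗ LinearMap.snd k _ _)
      (ar A a ∘ₗ LinearMap.snd k _ _)
  inj := homMk (fun i => LinearMap.inl k (sp B i) (sp A i)) fun i j a => by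
    refine LinearMap.ext fun x => ?_
    change ((ar B a x, 0) : sp B j × sp A j) = (ar B a x + c ⟨(i, j), a⟩ 0, ar A a 0)
    simp
  proj := homMk (fun i => LinearMap.snd k (sp B i) (sp A i)) fun i j a => by
    rfl
  sec := fun i => LinearMap.inr k (sp B i) (sp A i)
  ret := fun i => LinearMap.fst k (sp B i) (sp A i)
  inj_proj := hom_ext_lin fun i => LinearMap.snd_comp_inl k (sp B i) (sp A i)
  inj_ret := funext fun i => LinearMap.fst_comp_inl k (sp B i) (sp A i)
  sec_proj := funext fun i => LinearMap.snd_comp_inr k (sp B i) (sp A i)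
  total := funext fun i => by
    refine LinearMap.ext fun (x : sp B i × sp A i) => ?_
    change ((x.1, (0 : sp A i)) : sp B i × sp A i) + ((0 : sp B i), x.2) = x
    simp
  diff_sec := funext fun a => LinearMap.ext fun x => by
    change ((0 : sp B a.1.2), ar A a.2 x) - (ar B a.2 0 + c ⟨(a.1.1, a.1.2), a.2⟩ x, ar A a.2 x) =
      -((c a x, (0 : sp A a.1.2)) : sp B a.1.2 × sp A a.1.2)
    simp
  finrank_eq := fun i => Module.finrank_prod (R := k) (M := sp B i) (M' := sp A i)

namespace SplitExtension

variable {A B : QRep I k} {c : Coch1 A B} (e : SplitExtension c)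

theorem mono_inj : Mono e.inj := ⟨fun {W} f g h => toCoch_injective (by
  have h2 : ∀ f : W ⟶ B, toCoch f = pre (f ≫ e.inj) e.ret := fun f => by
    rw [← pre_pre, e.inj_ret, pre_toCoch, Category.comp_id]
  rw [h2 f, h2 g, h])⟩

/-- If a retraction of `B → E` exists, then the class of the extension vanishes. -/
theorem exists_diff_eq (r : e.E ⟶ B) (hr : e.inj ≫ r = 𝟙 B) : ∃ f, diff A B f = c :=
  ⟨- post r e.sec, by
    rw [map_neg, diff_post, e.diff_sec, map_neg, post_post, hr, post_id, neg_neg]⟩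

/-- `B → E` is a kernel of `E → A`. -/
theorem exists_factor {W : QRep I k} (f : W ⟶ e.E) (hf : f ≫ e.proj = 0) :
    ∃ g : W ⟶ B, g ≫ e.inj = f := by
  have := e.mono_inj
  have h1 : post e.inj (pre f e.ret) = toCoch f := by
    have h2 := congrArg (pre f) e.total
    rw [map_add, pre_pre, hf, pre_zero, add_zero, pre_toCoch, Category.comp_id, pre_post] at h2
    exact h2
  obtain ⟨g, hg⟩ := exists_toCoch (f := pre f e.ret) (by
    apply post_injective e.inj
    rw [← diff_post, h1, diff_toCoch, map_zero])
  exact ⟨g, toCoch_injective (by rw [← post_toCoch, hg, h1])⟩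

end SplitExtension

end Extensions

/-! ### Dimension vectors and indecomposable retracts -/

section Dimension

variable {I : Type} [Quiver.{0} I] {k : Type} [Field k] {X Y : QRep I k}

/-- The dimension vector of a representation. -/
def dv (X : QRep I k) (i : I) : ℤ := Module.finrank k (sp X i)

theorem dv_le_of_mono (f : X ⟶ Y) [Mono f] (i : I) : dv X i ≤ dv Y i :=
  Nat.cast_le.2 (LinearMap.finrank_le_finrank_of_injective (lin_injective f i))

theorem dv_congr (e : X ≅ Y) : dv X = dv Y :=
  funext fun i => le_antisymm (dv_le_of_mono e.hom i) (dv_le_of_mono e.inv i)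

theorem dv_biprod (A B : QRep I k) : dv (A ⊞ B) = dv A + dv B := by
  funext i
  have h1 : lin (biprod.fst : A ⊞ B ⟶ A) i ∘ₗ lin biprod.inl i = LinearMap.id := by
    rw [← lin_comp, biprod.inl_fst, lin_id]
  have h2 : lin (biprod.snd : A ⊞ B ⟶ B) i ∘ₗ lin biprod.inr i = LinearMap.id := by
    rw [← lin_comp, biprod.inr_snd, lin_id]
  have h3 : lin (biprod.snd : A ⊞ B ⟶ B) i ∘ₗ lin biprod.inl i = 0 := by
    rw [← lin_comp, biprod.inl_snd, lin_zero]
  have h4 : lin (biprod.fst : A ⊞ B ⟶ A) i ∘ₗ lin biprod.inr i = 0 := by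
    rw [← lin_comp, biprod.inr_fst, lin_zero]
  have h5 : lin (biprod.inl : A ⟶ A ⊞ B) i ∘ₗ lin biprod.fst i +
      lin (biprod.inr : B ⟶ A ⊞ B) i ∘ₗ lin biprod.snd i = LinearMap.id := by
    rw [← lin_comp, ← lin_comp, ← lin_add, biprod.total, lin_id]
  have e : sp (A ⊞ B) i ≃ₗ[k] sp A i × sp B i :=
    LinearEquiv.ofLinearMap
      (LinearMap.prod (lin biprod.fst i) (lin biprod.snd i))
      (LinearMap.coprod (lin biprod.inl i) (lin biprod.inr i))
      (by
        refine LinearMap.ext fun x => Prod.ext ?_ ?_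
        · change lin biprod.fst i (lin biprod.inl i x.1 + lin biprod.inr i x.2) = x.1
          rw [map_add]
          have := LinearMap.congr_fun h1 x.1
          have h := LinearMap.congr_fun h4 x.2
          simp only [LinearMap.comp_apply, LinearMap.id_apply, LinearMap.zero_apply] at this h
          rw [this, h, add_zero]
        · change lin biprod.snd i (lin biprod.inl i x.1 + lin biprod.inr i x.2) = x.2
          rw [map_add]
          have := LinearMap.congr_fun h2 x.2
          have h := LinearMap.congr_fun h3 x.1
          simp only [LinearMap.comp_apply, LinearMap.id_apply, LinearMap.zero_apply] at this h
          rw [this, h, zero_add])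
      (LinearMap.ext fun x => LinearMap.congr_fun h5 x)
  have := e.finrank_eq
  rw [Module.finrank_prod] at this
  simp only [dv, Pi.add_apply]
  exact_mod_cast this

/-- A nonzero retract of an indecomposable representation is everything. -/
theorem _root_.CategoryTheory.Indecomposable.isIso_of_retract (hX : Indecomposable X)
    (i : Y ⟶ X) (r : X ⟶ Y) (h : i ≫ r = 𝟙 Y) (hY : ¬ IsZero Y) : IsIso i := by
  have : Mono i := mono_of_mono_fac h
  let S : ShortComplex (QRep I k) := ShortComplex.mk i (cokernel.π i) (cokernel.condition i)
  have hS : S.Exact := S.exact_of_g_is_cokernel (cokernelIsCokernel i)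
  have e : X ≅ Y ⊞ cokernel i :=
    (ShortComplex.Splitting.ofExactOfRetraction S hS r h
      (inferInstanceAs (Epi (cokernel.π i)))).isoBinaryBiproduct
  have h0 : cokernel.π i = 0 := ((hX.2 _ _ e).resolve_left hY).eq_of_tgt _ _
  have : Epi i := Preadditive.epi_of_cokernel_zero h0
  exact isIso_of_mono_of_epi i

theorem finrank_coch {ι : Type} [Fintype ι] (s t : ι → I) (X Y : QRep I k) :
    (Module.finrank k (Coch s t X Y) : ℤ) = ∑ a, dv X (s a) * dv Y (t a) := by
  rw [Module.finrank_pi_fintype]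
  simp [Module.finrank_linearMap, dv]

variable [Fintype I]

/-- The total dimension of a representation. -/
def tdim (X : QRep I k) : ℕ := ∑ i, Module.finrank k (sp X i)

theorem tdim_eq (X : QRep I k) : (tdim X : ℤ) = ∑ i, dv X i := by simp [tdim, dv]

theorem tdim_le_of_mono (f : X ⟶ Y) [Mono f] : tdim X ≤ tdim Y :=
  Finset.sum_le_sum fun i _ => LinearMap.finrank_le_finrank_of_injective (lin_injective f i)

theorem tdim_le_of_epi (f : X ⟶ Y) [Epi f] : tdim Y ≤ tdim X :=
  Finset.sum_le_sum fun i _ => LinearMap.finrank_le_finrank_of_surjective (lin_surjective f i)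

theorem tdim_congr (e : X ≅ Y) : tdim X = tdim Y :=
  le_antisymm (tdim_le_of_mono e.hom) (tdim_le_of_mono e.inv)

theorem tdim_biprod (A B : QRep I k) : tdim (A ⊞ B) = tdim A + tdim B := by
  zify
  simp only [tdim_eq, dv_biprod, Pi.add_apply, Finset.sum_add_distrib]

theorem isIso_of_mono_of_tdim_le (f : X ⟶ Y) [Mono f] (h : tdim Y ≤ tdim X) : IsIso f := by
  have h1 : ∀ i, Module.finrank k (sp X i) ≤ Module.finrank k (sp Y i) := fun i =>
    LinearMap.finrank_le_finrank_of_injective (lin_injective f i)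
  have h2 := (Finset.sum_eq_sum_iff_of_le fun i (_ : i ∈ Finset.univ) => h1 i).1
    (le_antisymm (tdim_le_of_mono f) h)
  exact isIso_of_bijective f fun i => ⟨lin_injective f i,
    (LinearMap.injective_iff_surjective_of_finrank_eq_finrank (h2 i (Finset.mem_univ i))).1
      (lin_injective f i)⟩

theorem isIso_of_epi_of_tdim_le (f : X ⟶ Y) [Epi f] (h : tdim X ≤ tdim Y) : IsIso f := by
  have h1 : ∀ i, Module.finrank k (sp Y i) ≤ Module.finrank k (sp X i) := fun i =>
    LinearMap.finrank_le_finrank_of_surjective (lin_surjective f i)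
  have h2 := (Finset.sum_eq_sum_iff_of_le fun i (_ : i ∈ Finset.univ) => h1 i).1
    (le_antisymm (tdim_le_of_epi f) h)
  exact isIso_of_bijective f fun i =>
    ⟨(LinearMap.injective_iff_surjective_of_finrank_eq_finrank (h2 i (Finset.mem_univ i)).symm).2
      (lin_surjective f i), lin_surjective f i⟩

theorem isZero_iff_tdim : IsZero X ↔ tdim X = 0 := by
  constructor
  · intro h
    refine Finset.sum_eq_zero fun i _ => ?_
    have h0 : (LinearMap.id : sp X i →ₗ[k] sp X i) = 0 := by
      rw [← lin_id, h.eq_of_src (𝟙 X) 0, lin_zero]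
    rw [Module.finrank_eq_zero_iff_of_free]
    exact ⟨fun x y => by
      rw [← LinearMap.id_apply (R := k) x, ← LinearMap.id_apply (R := k) y, h0]; simp⟩
  · intro h
    rw [IsZero.iff_id_eq_zero]
    refine hom_ext_lin fun i => LinearMap.ext fun x => ?_
    have h1 : Module.finrank k (sp X i) = 0 := (Finset.sum_eq_zero_iff.1 h) i (Finset.mem_univ i)
    rw [Module.finrank_eq_zero_iff_of_free] at h1
    exact Subsingleton.elim _ _

/-- A property of retracts of `K` that excludes zero and passes from a direct sum to one of its two
summands holds for an indecomposable retract as soon as it holds for `K`. -/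
theorem exists_indecomposable_retract_of {K : QRep I k} (Q : ∀ W, Retract W K → Prop)
    (hzero : ∀ W ρ, Q W ρ → ¬ IsZero W)
    (hstep : ∀ W ρ, Q W ρ → ∀ A B (e : W ≅ A ⊞ B),
      Q A (Retract.trans ⟨biprod.inl ≫ e.inv, e.hom ≫ biprod.fst, by simp⟩ ρ) ∨
      Q B (Retract.trans ⟨biprod.inr ≫ e.inv, e.hom ≫ biprod.snd, by simp⟩ ρ))
    (h : Q K (Retract.refl K)) : ∃ W, ∃ ρ : Retract W K, Indecomposable W ∧ Q W ρ := by
  suffices ∀ n : ℕ, ∀ W ρ, tdim W ≤ n → Q W ρ →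
      ∃ W, ∃ ρ : Retract W K, Indecomposable W ∧ Q W ρ from this _ _ _ le_rfl h
  intro n
  induction n with
  | zero => exact fun W ρ hn hQ => absurd (isZero_iff_tdim.2 (Nat.le_zero.1 hn)) (hzero W ρ hQ)
  | succ n ih =>
    intro W ρ hn hQ
    by_cases hW : Indecomposable W
    · exact ⟨W, ρ, hW, hQ⟩
    · have h1 : ∃ A B, ∃ _ : W ≅ A ⊞ B, ¬ IsZero A ∧ ¬ IsZero B := by
        by_contra hc
        push Not at hc
        exact hW ⟨hzero W ρ hQ, fun A B e => or_iff_not_imp_left.2 fun hA => hc A B e hA⟩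
      obtain ⟨A, B, e, hA, hB⟩ := h1
      rw [isZero_iff_tdim] at hA hB
      have h2 := tdim_congr e
      rw [tdim_biprod] at h2
      rcases hstep W ρ hQ A B e with h | h
      · exact ih A _ (by omega) h
      · exact ih B _ (by omega) h

theorem exists_indecomposable_retract_comp_ne_zero {Z K : QRep I k} (g : Z ⟶ K) (hg : g ≠ 0) :
    ∃ W, ∃ ρ : Retract W K, Indecomposable W ∧ g ≫ ρ.r ≠ 0 := by
  refine exists_indecomposable_retract_of (fun W ρ => g ≫ ρ.r ≠ 0)
    (fun W ρ h hW => h (hW.eq_of_tgt _ _)) (fun W ρ h A B e => ?_) (by simpa using hg)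
  by_contra hc
  push Not at hc
  simp only [Retract.trans_r] at hc
  apply h
  rw [← cancel_mono e.hom]
  apply biprod.hom_ext
  · simpa using hc.1
  · simpa using hc.2

theorem exists_indecomposable_retract_not_extZero {A B : QRep I k} (h : ¬ ExtZero A B) :
    ∃ W, ∃ _ : Retract W A, Indecomposable W ∧ ¬ ExtZero W B := by
  refine exists_indecomposable_retract_of (fun W _ => ¬ ExtZero W B)
    (fun W ρ h hW => h fun c => ⟨0, ?_⟩) (fun W ρ h A' B' e => ?_) h
  · rw [map_zero, ← pre_id c, hW.eq_of_src (𝟙 W) 0, pre_zero]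
  · by_contra hc
    push Not at hc
    exact h (extZero_of_decomp_left hc.1 hc.2 (e.hom ≫ biprod.fst) (biprod.inl ≫ e.inv)
      (e.hom ≫ biprod.snd) (biprod.inr ≫ e.inv) (by
        have h3 : e.hom ≫ (biprod.fst ≫ biprod.inl + biprod.snd ≫ biprod.inr) ≫ e.inv = 𝟙 W := by
          rw [biprod.total, Category.id_comp, e.hom_inv_id]
        simpa only [Preadditive.comp_add, Preadditive.add_comp, Category.assoc] using h3))

end Dimension

/-! ### The Euler form of representations -/

section Euler

variable {I : Type} [Fintype I] [Quiver.{0} I] {k : Type} [Field k]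

instance finite_hom (X Y : QRep I k) : Module.Finite k (X ⟶ Y) :=
  Module.Finite.equiv (homEquivKer X Y).symm

/-- `dim Hom(X, Y) - dim Ext¹(X, Y)` is the Euler form of the dimension vectors. -/
theorem finrank_hom_sub_finrank_ext (hfin : ∀ i j : I, Finite (i ⟶ j)) (X Y : QRep I k) :
    (Module.finrank k (X ⟶ Y) : ℤ) - Module.finrank k (Coch1 X Y ⧸ LinearMap.range (diff X Y)) =
      eulerForm I (dv X) (dv Y) := by
  have : ∀ p : I × I, Fintype (p.1 ⟶ p.2) := fun p => Fintype.ofFinite _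
  have h1 := LinearMap.finrank_range_add_finrank_ker (diff X Y)
  have h2 := Submodule.finrank_quotient_add_finrank (LinearMap.range (diff X Y))
  have h3 := finrank_coch (fun i : I => i) (fun i : I => i) X Y
  have h4 := finrank_coch (fun a : Arr I => a.1.1) (fun a : Arr I => a.1.2) X Y
  have h5 : ∑ a : Arr I, dv X a.1.1 * dv Y a.1.2 =
      ∑ i, ∑ j, (Nat.card (i ⟶ j) : ℤ) * dv X i * dv Y j := by
    rw [Fintype.sum_sigma, Fintype.sum_prod_type]
    refine Finset.sum_congr rfl fun i _ => Finset.sum_congr rfl fun j _ => ?_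
    have hc : Nat.card (i ⟶ j) = @Fintype.card (i ⟶ j) (this (i, j)) :=
      @Nat.card_eq_fintype_card _ (this (i, j))
    simp [hc, mul_assoc]
  rw [(homEquivKer X Y).finrank_eq, eulerForm, ← h5, ← h4, ← h3]
  zify at h1 h2
  linarith

theorem ExtZero.finrank_hom (hfin : ∀ i j : I, Finite (i ⟶ j)) {X Y : QRep I k}
    (h : ExtZero X Y) : (Module.finrank k (X ⟶ Y) : ℤ) = eulerForm I (dv X) (dv Y) := by
  rw [← finrank_hom_sub_finrank_ext hfin, LinearMap.range_eq_top.2 h,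
    Module.finrank_zero_of_subsingleton (M := Coch1 X Y ⧸ (⊤ : Submodule k (Coch1 X Y)))]
  simp

theorem eulerForm_le_finrank_hom (hfin : ∀ i j : I, Finite (i ⟶ j)) (X Y : QRep I k) :
    eulerForm I (dv X) (dv Y) ≤ Module.finrank k (X ⟶ Y) := by
  rw [← finrank_hom_sub_finrank_ext hfin]
  omega

end Euler

/-! ### The Euler form of a Dynkin quiver -/

section Dynkin

variable {I : Type} [Fintype I] [Quiver.{0} I]

theorem eulerForm_add_left (x x' y : I → ℤ) :
    eulerForm I (x + x') y = eulerForm I x y + eulerForm I x' y := by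
  simp only [eulerForm, Pi.add_apply, add_mul, mul_add, Finset.sum_add_distrib]
  ring

theorem eulerForm_add_right (x y y' : I → ℤ) :
    eulerForm I x (y + y') = eulerForm I x y + eulerForm I x y' := by
  simp only [eulerForm, Pi.add_apply, mul_add, Finset.sum_add_distrib]
  ring

theorem eulerForm_smul_left (c : ℤ) (x y : I → ℤ) :
    eulerForm I (c • x) y = c * eulerForm I x y := by
  simp only [eulerForm, Pi.smul_apply, smul_eq_mul, mul_sub, Finset.mul_sum]
  congr 1
  · exact Finset.sum_congr rfl fun i _ => by ring
  · exact Finset.sum_congr rfl fun i _ => Finset.sum_congr rfl fun j _ => by ring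

theorem eulerForm_smul_right (c : ℤ) (x y : I → ℤ) :
    eulerForm I x (c • y) = c * eulerForm I x y := by
  simp only [eulerForm, Pi.smul_apply, smul_eq_mul, mul_sub, Finset.mul_sum]
  congr 1
  · exact Finset.sum_congr rfl fun i _ => by ring
  · exact Finset.sum_congr rfl fun i _ => Finset.sum_congr rfl fun j _ => by ring

variable [DecidableEq I]

/-- The symmetrised Euler form as a bilinear form. -/
def symBilin (I : Type) [Fintype I] [DecidableEq I] [Quiver.{0} I] :
    LinearMap.BilinForm ℤ (I → ℤ) :=
  LinearMap.mk₂ ℤ (symForm I)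
    (fun x x' y => by simp only [symForm, eulerForm_add_left, eulerForm_add_right]; ring)
    (fun c x y => by
      simp only [symForm, eulerForm_smul_left, eulerForm_smul_right, smul_eq_mul]; ring)
    (fun x y y' => by simp only [symForm, eulerForm_add_left, eulerForm_add_right]; ring)
    (fun c x y => by
      simp only [symForm, eulerForm_smul_left, eulerForm_smul_right, smul_eq_mul]; ring)

theorem symForm_eq_sum (x y : I → ℤ) :
    symForm I x y = ∑ i, ∑ j, x i * cartanMatrix I i j * y j := by
  have h := LinearMap.BilinForm.sum_repr_mul_repr_mul (B := symBilin I) (Pi.basisFun ℤ I) x y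
  rw [Finsupp.sum_fintype _ _ (by intro i; simp [Finsupp.sum])] at h
  refine (Eq.symm h).trans (Finset.sum_congr rfl fun i _ => ?_)
  rw [Finsupp.sum_fintype _ _ (by intro i; simp)]
  refine Finset.sum_congr rfl fun j _ => ?_
  simp only [Pi.basisFun_repr, Pi.basisFun_apply, smul_eq_mul, cartanMatrix, Matrix.of_apply]
  change x i * (y j * symForm I (simpleRoot I i) (simpleRoot I j)) = _
  ring

theorem IsDynkin.eulerForm_pos (hQ : IsDynkin I) {x : I → ℤ} (hx : x ≠ 0) :
    0 < eulerForm I x x := by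
  have h := hQ.posDef.2 (x := Finsupp.equivFunOnFinite.symm x) (fun h0 =>
    hx (Finsupp.equivFunOnFinite.symm.injective (h0.trans (Finsupp.ext fun _ => rfl))))
  rw [Finsupp.sum_fintype _ _ (by intro i; simp [Finsupp.sum])] at h
  have h1 : symForm I x x = eulerForm I x x + eulerForm I x x := rfl
  rw [symForm_eq_sum] at h1
  have h2 : ∀ i, ((Finsupp.equivFunOnFinite.symm x).sum fun j xj =>
      star (Finsupp.equivFunOnFinite.symm x i) * cartanMatrix I i j * xj) =
      ∑ j, x i * cartanMatrix I i j * x j := fun i => by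
    rw [Finsupp.sum_fintype _ _ (by intro i; simp)]
    rfl
  rw [Finset.sum_congr rfl fun i _ => h2 i, h1] at h
  omega

theorem IsDynkin.eulerForm_simpleRoot (hQ : IsDynkin I) (i : I) :
    eulerForm I (simpleRoot I i) (simpleRoot I i) = 1 := by
  have h := hQ.eulerForm_pos (x := simpleRoot I i) (by simp [simpleRoot])
  have h1 : eulerForm I (simpleRoot I i) (simpleRoot I i) = 1 - (Nat.card (i ⟶ i) : ℤ) := by
    simp [eulerForm, simpleRoot, Pi.single_apply]
  omega

theorem IsDynkin.eulerForm_root (hQ : IsDynkin I) {β : I → ℤ} (hβ : IsRoot I β) :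
    eulerForm I β β = 1 := by
  induction hβ with
  | simple i => exact hQ.eulerForm_simpleRoot i
  | reflect i β _ ih =>
    have h1 := hQ.eulerForm_simpleRoot i
    rw [sub_eq_add_neg, ← neg_smul]
    simp only [eulerForm_add_left, eulerForm_add_right, eulerForm_smul_left, eulerForm_smul_right,
      ih, h1, symForm]
    ring

end Dynkin

/-! ### Indecomposable representations of a Dynkin quiver are rigid bricks -/

section Bricks

variable {I : Type} [Quiver.{0} I] {k : Type} [Field k] {X Y : QRep I k}

/-- A brick: a nonzero representation whose endomorphism ring is a division ring. -/
structure IsBrick (X : QRep I k) : Prop where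
  not_isZero : ¬ IsZero X
  isIso : ∀ f : X ⟶ X, f ≠ 0 → IsIso f

/-- A nonzero retract of a brick is everything. -/
theorem IsBrick.isIso_of_retract (hX : IsBrick X) (i : Y ⟶ X) (r : X ⟶ Y) (h : i ≫ r = 𝟙 Y)
    (hY : ¬ IsZero Y) : IsIso i := by
  have h0 : r ≫ i ≠ 0 := fun h0 => hY <| by
    have h1 : 𝟙 Y = i ≫ (r ≫ i) ≫ r := by rw [Category.assoc, reassoc_of% h, h]
    rw [IsZero.iff_id_eq_zero, h1, h0, zero_comp, comp_zero]
  have := hX.isIso _ h0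
  have : Epi i := epi_of_epi r i
  have : Mono i := mono_of_mono_fac h
  exact isIso_of_mono_of_epi i

variable [Fintype I]

theorem dv_ne_zero (hX : ¬ IsZero X) : dv X ≠ 0 := fun h => hX <| by
  rw [isZero_iff_tdim]
  zify
  rw [tdim_eq, h]
  simp

theorem tdim_lt_of_mono (f : X ⟶ Y) [Mono f] (hf : ¬ IsIso f) : tdim X < tdim Y :=
  lt_of_not_ge fun h => hf (isIso_of_mono_of_tdim_le f h)

theorem isIso_of_epi_endo (f : X ⟶ X) [Epi f] : IsIso f := isIso_of_epi_of_tdim_le f le_rfl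

variable [DecidableEq I]

/-- A nonzero self-extension class `c` of a brick `X` would give an embedding `f ↦ f · c` of
`End(X)` into `Ext¹(X, X)`, contradicting the positivity of the Euler form. -/
theorem IsBrick.extZero (hQ : IsDynkin I) (hX : IsBrick X) : ExtZero X X := by
  by_contra hc
  obtain ⟨c, hc⟩ : ∃ c, ∀ g, diff X X g ≠ c := by
    simpa [ExtZero, Function.Surjective] using hc
  let φ : (X ⟶ X) →ₗ[k] Coch1 X X ⧸ LinearMap.range (diff X X) :=
    { toFun := fun f => Submodule.Quotient.mk (post f c)
      map_add' := fun f g => rfl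
      map_smul' := fun r f => rfl }
  have hφ : Function.Injective φ := by
    rw [← LinearMap.ker_eq_bot, LinearMap.ker_eq_bot']
    intro f hf
    by_contra hf0
    have := hX.isIso f hf0
    obtain ⟨g, hg⟩ := (Submodule.Quotient.mk_eq_zero _).1 hf
    exact hc (post (inv f) g) (by rw [diff_post, hg, post_post, IsIso.hom_inv_id, post_id])
  have : ∀ p : I × I, Finite (p.1 ⟶ p.2) := fun p => hQ.finite_arrows _ _
  have h1 := LinearMap.finrank_le_finrank_of_injective hφ
  have h2 := finrank_hom_sub_finrank_ext hQ.finite_arrows X X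
  have h3 := hQ.eulerForm_pos (dv_ne_zero hX.not_isZero)
  omega

/-- If `X` is indecomposable but not a brick, then the smallest image `Z` of a nonzero non-invertible
endomorphism embeds into an indecomposable summand `W` of the kernel; as `W` is rigid by induction, the
projection of the kernel to `W` extends to `X`, so that `W` is a summand of `X`. -/
theorem isBrick_of_indecomposable (hQ : IsDynkin I) (hX : Indecomposable X) : IsBrick X := by
  induction hn : tdim X using Nat.strong_induction_on generalizing X with
  | _ n ih =>
  refine ⟨hX.1, ?_⟩
  by_contra! hc
  obtain ⟨θ, hθ0, hθ⟩ := hc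
  -- The proper nonzero objects that are both a quotient and a subobject of `X`.
  let P : ℕ → Prop := fun d => ∃ Z : QRep I k, ∃ p : X ⟶ Z, ∃ m : Z ⟶ X,
    Epi p ∧ Mono m ∧ ¬ IsZero Z ∧ ¬ IsIso m ∧ tdim Z = d
  have hP : ∃ d, P d := by
    refine ⟨_, Abelian.image θ, Abelian.factorThruImage θ, Abelian.image.ι θ, inferInstance,
      inferInstance, fun h => hθ0 ?_, fun h => hθ ?_, rfl⟩
    · rw [← Abelian.image.fac θ, h.eq_of_src (Abelian.image.ι θ) 0, comp_zero]
    · have : Epi θ := by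
        rw [← Abelian.image.fac θ]
        exact epi_comp _ _
      exact isIso_of_epi_endo θ
  classical
  obtain ⟨Z, p, m, hp, hm, hZ, hmi, hd⟩ := Nat.find_spec hP
  have hmin : ∀ Z' : QRep I k, ∀ p : X ⟶ Z', ∀ m : Z' ⟶ X, Epi p → Mono m → ¬ IsZero Z' →
      ¬ IsIso m → tdim Z ≤ tdim Z' := fun Z' p m h1 h2 h3 h4 => by
    rw [hd]
    exact Nat.find_min' hP ⟨Z', p, m, h1, h2, h3, h4, rfl⟩
  have hZX := tdim_lt_of_mono m hmi
  -- Otherwise `m ≫ p` is invertible by minimality, and `Z` is a proper summand of `X`.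
  have hmp : m ≫ p = 0 := by
    by_contra h0
    set a := Abelian.factorThruImage (m ≫ p)
    set b := Abelian.image.ι (m ≫ p)
    have hab : a ≫ b = m ≫ p := Abelian.image.fac _
    have h1 : tdim Z ≤ tdim (Abelian.image (m ≫ p)) := by
      refine hmin _ (p ≫ a) (b ≫ m) (epi_comp _ _) (mono_comp _ _) (fun h => h0 ?_)
        (fun h => hmi ?_)
      · rw [← hab, h.eq_of_src b 0, comp_zero]
      · have : Epi m := epi_of_epi b m
        exact isIso_of_mono_of_epi m
    have : IsIso b := isIso_of_mono_of_tdim_le b h1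
    have : Epi (m ≫ p) := by
      rw [← hab]
      exact epi_comp _ _
    have := isIso_of_epi_endo (m ≫ p)
    exact hmi (hX.isIso_of_retract m (p ≫ inv (m ≫ p))
      (by rw [← Category.assoc, IsIso.hom_inv_id]) hZ)
  have hS : (ShortComplex.mk (kernel.ι p) p (kernel.condition p)).ShortExact :=
    { exact := ShortComplex.exact_of_f_is_kernel _ (kernelIsKernel p) }
  have hj0 : kernel.lift p m hmp ≠ 0 := fun h => hZ <| by
    have h1 : m = 0 := by rw [← kernel.lift_ι p m hmp, h, zero_comp]
    rw [IsZero.iff_id_eq_zero, ← cancel_mono m, h1, comp_zero, comp_zero]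
  obtain ⟨W, ρ, hW, hg⟩ := exists_indecomposable_retract_comp_ne_zero _ hj0
  set g := kernel.lift p m hmp ≫ ρ.r
  have hKX : ¬ IsIso (kernel.ι p) := fun h => hZ <| by
    have h1 : p = 0 := by rw [← cancel_epi (kernel.ι p), kernel.condition, comp_zero]
    rw [IsZero.iff_id_eq_zero, ← cancel_epi p, h1, zero_comp, zero_comp]
  have hWX : tdim W < tdim X :=
    lt_of_le_of_lt (tdim_le_of_mono ρ.i) (tdim_lt_of_mono _ hKX)
  -- The image of `g` is again a quotient and a subobject of `X`, so minimality applies to it.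
  have hg_mono : Mono g := by
    set a := Abelian.factorThruImage g
    set b := Abelian.image.ι g
    have hab : a ≫ b = g := Abelian.image.fac _
    have h2 : tdim (Abelian.image g) ≤ tdim Z := tdim_le_of_epi a
    have h1 : tdim Z ≤ tdim (Abelian.image g) := by
      refine hmin _ (p ≫ a) (b ≫ ρ.i ≫ kernel.ι p) (epi_comp _ _)
        (mono_comp' inferInstance (mono_comp _ _)) (fun h => hg ?_) (fun h => ?_)
      · rw [← hab, h.eq_of_src b 0, comp_zero]
      · have := tdim_le_of_epi (b ≫ ρ.i ≫ kernel.ι p)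
        omega
    have : IsIso a := isIso_of_epi_of_tdim_le a h1
    rw [← hab]
    exact mono_comp _ _
  have hWr : ExtZero Z W := ((ih _ (hn ▸ hWX) hW rfl).extZero hQ).of_mono g
  obtain ⟨r, hr⟩ := ExtZero.exists_extend hS hWr ρ.r
  have hi := hX.isIso_of_retract (ρ.i ≫ kernel.ι p) r
    (by rw [Category.assoc]; exact (congrArg (ρ.i ≫ ·) hr).trans ρ.retract) hW.1
  exact absurd (tdim_le_of_epi (ρ.i ≫ kernel.ι p)) (not_le.2 hWX)

end Bricks

/-! ### Morphisms and extensions between rigid bricks -/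

section Directed

variable {I : Type} [Quiver.{0} I] {k : Type} [Field k] {X Y : QRep I k}

/-- The image and the cokernel of a morphism. -/
theorem exists_shortExact_of_hom (f : X ⟶ Y) : ∃ (Z C : QRep I k) (p : X ⟶ Z) (m : Z ⟶ Y)
    (q : Y ⟶ C) (w : m ≫ q = 0), (ShortComplex.mk m q w).ShortExact ∧ Epi p ∧ p ≫ m = f :=
  ⟨Abelian.image f, cokernel (Abelian.image.ι f), Abelian.factorThruImage f, Abelian.image.ι f,
    cokernel.π _, cokernel.condition _,
    { exact := ShortComplex.exact_of_g_is_cokernel _ (cokernelIsCokernel _) },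
    inferInstance, Abelian.image.fac f⟩

theorem post_sum {ι : Type} {s t : ι → I} {Y' : QRep I k} {σ : Type} (S : Finset σ)
    (w : σ → (Y ⟶ Y')) (c : Coch s t X Y) :
    post (∑ l ∈ S, w l) c = ∑ l ∈ S, post (w l) c := by
  classical
  induction S using Finset.induction_on with
  | empty => simp
  | insert a S ha ih => rw [Finset.sum_insert ha, Finset.sum_insert ha, post_add, ih]

theorem ExtZero.biproduct {n : ℕ} (h : ExtZero X Y) : ExtZero X (⨁ fun _ : Fin n => Y) :=
    fun c => by
  choose f hf using fun l => h (post (biproduct.π (fun _ : Fin n => Y) l) c)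
  refine ⟨∑ l, post (biproduct.ι (fun _ : Fin n => Y) l) (f l), ?_⟩
  rw [map_sum]
  simp only [diff_post, hf, post_post]
  rw [← post_sum, biproduct.total, post_id]

theorem SplitExtension.shortExact {A B : QRep I k} {c : Coch1 A B} (e : SplitExtension c) :
    (ShortComplex.mk e.inj e.proj e.inj_proj).ShortExact :=
  have := e.mono_inj
  { exact := ShortComplex.exact_of_f_is_kernel _
      (KernelFork.IsLimit.ofι' _ _ fun g hg =>
        ⟨(e.exists_factor g hg).choose, (e.exists_factor g hg).choose_spec⟩)
    epi_g := ⟨fun {W} f g h => toCoch_injective (by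
      have h1 : ∀ f : A ⟶ W, toCoch f = post (e.proj ≫ f) e.sec := fun f => by
        rw [← post_post, e.sec_proj, post_toCoch, Category.id_comp]
      rw [h1 f, h1 g, h])⟩ }

/-- The lemma of Happel and Ringel: if `Ext¹(Y, X) = 0`, then the nonzero morphisms `X → Y` are
injective or surjective. -/
theorem mono_or_epi_of_extZero (hX : IsBrick X) (hY : IsBrick Y) (h : ExtZero Y X) (f : X ⟶ Y)
    (hf : f ≠ 0) : Mono f ∨ Epi f := by
  obtain ⟨Z, C, p, m, q, w, hS, hp, hpm⟩ := exists_shortExact_of_hom f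
  have hm : Mono m := hS.mono_f
  -- The class of `0 → im f → Y → coker f → 0` lifts along `p` to a class of extensions of
  -- `coker f` by `X`, which vanishes on `Y`.
  obtain ⟨ρ, hρ⟩ := pre_surjective m (toCoch (𝟙 Z))
  obtain ⟨c, hc⟩ := exists_pre_of_pre_eq_zero hS (diff _ _ ρ)
    (by rw [← diff_pre, hρ, diff_toCoch])
  obtain ⟨c', rfl⟩ := post_surjective p c
  obtain ⟨g, hg⟩ := h (pre q c')
  obtain ⟨u, hu⟩ := exists_toCoch (f := ρ - post p g) (by
    rw [map_sub, diff_post, hg, ← pre_post, hc, sub_self])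
  obtain ⟨s, hs⟩ := exists_toCoch (f := pre m g) (by
    rw [diff_pre, hg, pre_pre, w, pre_zero])
  have hus : m ≫ u + s ≫ p = 𝟙 _ := toCoch_injective (by
    rw [toCoch_add, ← pre_toCoch, ← post_toCoch, hu, hs, map_sub, hρ, pre_post, sub_add_cancel])
  by_cases h0 : p ≫ s = 0
  · right
    have h1 : m ≫ u = 𝟙 _ := by
      rw [← cancel_epi p, ← hus, Preadditive.comp_add, reassoc_of% h0, zero_comp, add_zero]
    have hZ : ¬ IsZero Z := fun hZ => hf (by
      rw [← hpm, hZ.eq_of_src m 0, comp_zero])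
    have := hY.isIso_of_retract m u h1 hZ
    rw [← hpm]
    exact epi_comp _ _
  · left
    have := hX.isIso _ h0
    have : Mono p := mono_of_mono p s
    rw [← hpm]
    exact mono_comp _ _

variable [Fintype I]

/-- For rigid bricks, `Ext¹(X, Y)` and `Ext¹(Y, X)` are not both nonzero.  Otherwise the universal
extension `0 → Y → E → X^n → 0` would have an indecomposable summand `W` with `Ext¹(W, X) ≠ 0` and
`Ext¹(X, W) = 0`.  By the lemma of Happel and Ringel there is no nonzero morphism `W → X`, so `W`
lies in `Y`, and the extension splits. -/
theorem extZero_or_extZero (hfin : ∀ i j : I, Finite (i ⟶ j))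
    (hind : ∀ W : QRep I k, Indecomposable W → IsBrick W ∧ ExtZero W W)
    (hX : IsBrick X) (hY : IsBrick Y) (hXX : ExtZero X X) :
    ExtZero X Y ∨ ExtZero Y X := by
  by_contra! hc
  obtain ⟨hXY, hYX⟩ := hc
  have : ∀ p : I × I, Finite (p.1 ⟶ p.2) := fun p => hfin _ _
  obtain ⟨n, cl, hcl⟩ : ∃ n, ∃ cl : Fin n → Coch1 X Y, Submodule.span k (Set.range cl) = ⊤ :=
    Module.Finite.exists_fin
  let c : Coch1 (⨁ fun _ : Fin n => X) Y := ∑ l, pre (biproduct.π (fun _ : Fin n => X) l) (cl l)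
  have hc : ∀ l, pre (biproduct.ι (fun _ : Fin n => X) l) c = cl l := fun l => by
    simp only [c, map_sum, pre_pre]
    rw [Finset.sum_eq_single l]
    · rw [biproduct.ι_π_self, pre_id]
    · intro l' _ h
      rw [biproduct.ι_π_ne _ h.symm, pre_zero]
    · simp
  let e := splitExtension c
  have hmono := e.mono_inj
  have hepi : Epi e.proj := e.shortExact.epi_g
  -- The connecting map `Hom(X, X^n) → Ext¹(X, Y)` is surjective, because the `cl l` span.
  have hXE : ExtZero X e.E := fun x => by
    obtain ⟨f, hf⟩ := hXX.biproduct (post e.proj x)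
    obtain ⟨f', rfl⟩ := post_surjective e.proj f
    obtain ⟨y, hy⟩ := exists_post_of_post_eq_zero e.shortExact (x - diff _ _ f')
      (by rw [map_sub, ← diff_post, hf, sub_self])
    have h1 : Submodule.span k (Set.range cl) ≤
        (LinearMap.range (diff X e.E)).comap (post e.inj) := by
      rw [Submodule.span_le]
      rintro _ ⟨l, rfl⟩
      refine ⟨- pre (biproduct.ι (fun _ : Fin n => X) l) e.sec, ?_⟩
      rw [map_neg, diff_pre, e.diff_sec, map_neg, neg_neg, pre_post, hc]
    rw [hcl] at h1
    obtain ⟨g, hg⟩ := h1 (Submodule.mem_top (x := y))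
    exact ⟨g + f', by rw [map_add, hg]; exact eq_sub_iff_add_eq.1 hy⟩
  obtain ⟨W, ρ, hW, hWX⟩ := exists_indecomposable_retract_not_extZero
    (fun h : ExtZero e.E X => hYX (h.of_mono e.inj))
  obtain ⟨hWb, hWW⟩ := hind W hW
  have hXW : ExtZero X W := hXE.of_epi ρ.r
  have hom_zero : ∀ f : W ⟶ X, f = 0 := fun f => by
    by_contra hf
    rcases mono_or_epi_of_extZero hWb hX hXW f hf with h | h
    · exact hWX (hXX.of_mono f)
    · exact hWX (hWW.of_epi f)
  obtain ⟨j, hj⟩ := e.exists_factor ρ.i (biproduct.hom_ext _ _ fun l => by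
    rw [hom_zero ((ρ.i ≫ e.proj) ≫ _), zero_comp])
  have hji : j ≫ e.inj ≫ ρ.r = 𝟙 W := by rw [reassoc_of% hj, ρ.retract]
  have := hY.isIso_of_retract j (e.inj ≫ ρ.r) hji hWb.not_isZero
  obtain ⟨f, hf⟩ := e.exists_diff_eq (ρ.r ≫ j) (by
    rw [← cancel_epi j, ← Category.assoc e.inj, ← Category.assoc j, hji, Category.id_comp,
      Category.comp_id])
  refine hXY (LinearMap.range_eq_top.1 (top_le_iff.1 (hcl ▸ Submodule.span_le.2 ?_)))
  rintro _ ⟨l, rfl⟩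
  exact ⟨pre (biproduct.ι (fun _ : Fin n => X) l) f, by rw [diff_pre, hf, hc]⟩

end Directed

section DynkinHom

variable {I : Type} [Fintype I] [DecidableEq I] [Quiver.{0} I] {k : Type} [Field k]
  {X Y : QRep I k}

theorem hom_eq_zero_or_extZero (hQ : IsDynkin I) (hX : Indecomposable X)
    (hY : Indecomposable Y) : (∀ f : X ⟶ Y, f = 0) ∨ ExtZero X Y := by
  have hind : ∀ W : QRep I k, Indecomposable W → IsBrick W ∧ ExtZero W W := fun W hW =>
    ⟨isBrick_of_indecomposable hQ hW, (isBrick_of_indecomposable hQ hW).extZero hQ⟩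
  obtain ⟨hXb, hXX⟩ := hind X hX
  obtain ⟨hYb, hYY⟩ := hind Y hY
  rcases extZero_or_extZero hQ.finite_arrows hind hXb hYb hXX with h | h
  · exact Or.inr h
  · refine or_iff_not_imp_left.2 fun h0 => ?_
    push Not at h0
    obtain ⟨f, hf⟩ := h0
    rcases mono_or_epi_of_extZero hXb hYb h f hf with h1 | h1
    · exact hYY.of_mono f
    · exact hXX.of_epi f

/-- The dimension of `Hom(X, Y)` for indecomposable `X` and `Y` depends only on their dimension
vectors. -/
theorem finrank_hom_of_indecomposable (hQ : IsDynkin I) (hX : Indecomposable X)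
    (hY : Indecomposable Y) :
    (Module.finrank k (X ⟶ Y) : ℤ) = max 0 (eulerForm I (dv X) (dv Y)) := by
  rcases hom_eq_zero_or_extZero hQ hX hY with h | h
  · have h1 : Module.finrank k (X ⟶ Y) = 0 := by
      rw [Module.finrank_eq_zero_iff_of_free]
      exact ⟨fun f g => (h f).trans (h g).symm⟩
    have h2 := eulerForm_le_finrank_hom hQ.finite_arrows X Y
    rw [h1] at h2 ⊢
    exact (max_eq_left (by exact_mod_cast h2)).symm
  · have h1 := h.finrank_hom hQ.finite_arrows
    rw [← h1, max_eq_right (by positivity)]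

theorem finrank_end_of_indecomposable (hQ : IsDynkin I) (hX : Indecomposable X) :
    (Module.finrank k (X ⟶ X) : ℤ) = eulerForm I (dv X) (dv X) :=
  ((isBrick_of_indecomposable hQ hX).extZero hQ).finrank_hom hQ.finite_arrows

end DynkinHom

/-! ### Existence of indecomposable representations -/

section Existence

variable {I : Type} [Quiver.{0} I] {k : Type} [Field k] {A B X : QRep I k}

theorem exists_dv_eq {x : I → ℤ} (hx : ∀ i, 0 ≤ x i) : ∃ X : QRep I k, dv X = x :=
  ⟨repMk (fun i => Fin (x i).toNat → k) fun _ => 0, funext fun i => by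
    have h : Module.finrank k (Fin (x i).toNat → k) = (x i).toNat := by simp
    exact (congrArg Nat.cast h).trans (Int.toNat_of_nonneg (hx i))⟩

theorem SplitExtension.dv_eq {c : Coch1 A B} (e : SplitExtension c) : dv e.E = dv A + dv B := by
  funext i
  simp only [dv, Pi.add_apply, e.finrank_eq i]
  push_cast
  ring

variable [Fintype I]

theorem finrank_hom_biprod_right (X A B : QRep I k) :
    Module.finrank k (X ⟶ A ⊞ B) = Module.finrank k (X ⟶ A) + Module.finrank k (X ⟶ B) := by
  rw [← Module.finrank_prod]
  refine LinearEquiv.finrank_eq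
    { toFun := fun f => (f ≫ biprod.fst, f ≫ biprod.snd)
      invFun := fun f => biprod.lift f.1 f.2
      map_add' := fun f g => by simp
      map_smul' := fun r f => by simp
      left_inv := fun f => by apply biprod.hom_ext <;> simp
      right_inv := fun f => by simp }

theorem finrank_hom_biprod_left (X A B : QRep I k) :
    Module.finrank k (A ⊞ B ⟶ X) = Module.finrank k (A ⟶ X) + Module.finrank k (B ⟶ X) := by
  rw [← Module.finrank_prod]
  refine LinearEquiv.finrank_eq
    { toFun := fun f => (biprod.inl ≫ f, biprod.inr ≫ f)
      invFun := fun f => biprod.desc f.1 f.2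
      map_add' := fun f g => by simp
      map_smul' := fun r f => by simp
      left_inv := fun f => by apply biprod.hom_ext' <;> simp
      right_inv := fun f => by simp }

/-- `Hom(X, )` is left exact. -/
theorem finrank_hom_le_right {S : ShortComplex (QRep I k)} (h : S.ShortExact) (X : QRep I k) :
    Module.finrank k (X ⟶ S.X₂) ≤ Module.finrank k (X ⟶ S.X₁) + Module.finrank k (X ⟶ S.X₃) := by
  have := h.mono_f
  rw [← LinearMap.finrank_range_add_finrank_ker (Linear.rightComp k X S.g), add_comm]
  refine add_le_add ?_ (Submodule.finrank_le _)
  have h1 : LinearMap.ker (Linear.rightComp k X S.g) ≤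
      LinearMap.range (Linear.rightComp k X S.f) := fun f hf =>
    ⟨h.exact.lift f hf, h.exact.lift_f f hf⟩
  exact (Submodule.finrank_mono h1).trans (LinearMap.finrank_range_le _)

/-- `Hom( , X)` is left exact. -/
theorem finrank_hom_le_left {S : ShortComplex (QRep I k)} (h : S.ShortExact) (X : QRep I k) :
    Module.finrank k (S.X₂ ⟶ X) ≤
      Module.finrank k (S.X₃ ⟶ X) +
        Module.finrank k (LinearMap.range (Linear.leftComp k X S.f)) := by
  have := h.epi_g
  rw [← LinearMap.finrank_range_add_finrank_ker (Linear.leftComp k X S.f), add_comm]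
  refine add_le_add ?_ le_rfl
  have h1 : LinearMap.ker (Linear.leftComp k X S.f) ≤
      LinearMap.range (Linear.leftComp k X S.g) := fun f hf =>
    ⟨h.exact.desc f hf, h.exact.g_desc f hf⟩
  exact (Submodule.finrank_mono h1).trans (LinearMap.finrank_range_le _)

/-- The endomorphism algebra of a nonsplit extension is smaller than that of the direct sum. -/
theorem exists_finrank_end_lt (h : ¬ ExtZero A B) : ∃ E : QRep I k, dv E = dv A + dv B ∧
    Module.finrank k (E ⟶ E) < Module.finrank k (A ⊞ B ⟶ A ⊞ B) := by
  obtain ⟨c, hc⟩ : ∃ c, ∀ g, diff A B g ≠ c := by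
    simpa [ExtZero, Function.Surjective] using h
  let e := splitExtension c
  refine ⟨e.E, e.dv_eq, ?_⟩
  have h1 := finrank_hom_le_right e.shortExact e.E
  have h2 := finrank_hom_le_left e.shortExact A
  have h3 := finrank_hom_le_left e.shortExact B
  have h4 := Submodule.finrank_le (LinearMap.range (Linear.leftComp k A e.inj))
  have h5 : Module.finrank k (LinearMap.range (Linear.leftComp k B e.inj)) <
      Module.finrank k (B ⟶ B) := by
    refine Submodule.finrank_lt fun htop => ?_
    obtain ⟨r, hr⟩ := LinearMap.range_eq_top.1 htop (𝟙 B)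
    obtain ⟨f, hf⟩ := e.exists_diff_eq r hr
    exact hc f hf
  rw [finrank_hom_biprod_right, finrank_hom_biprod_left, finrank_hom_biprod_left]
  dsimp only at h1 h2 h3
  omega

variable [DecidableEq I]

/-- Among the representations of dimension vector `x`, one with the smallest endomorphism algebra
has no extensions between complementary summands; if `⟨x, x⟩ = 1`, it is indecomposable by
positivity. -/
theorem exists_indecomposable (hQ : IsDynkin I) {x : I → ℤ} (hx : ∀ i, 0 ≤ x i)
    (hx1 : eulerForm I x x = 1) : ∃ X : QRep I k, Indecomposable X ∧ dv X = x := by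
  classical
  let P : ℕ → Prop := fun n => ∃ X : QRep I k, dv X = x ∧ Module.finrank k (X ⟶ X) = n
  have hP : ∃ n, P n := (exists_dv_eq hx).elim fun X hX => ⟨_, X, hX, rfl⟩
  obtain ⟨X, hX, hn⟩ := Nat.find_spec hP
  have key : ∀ A B : QRep I k, (X ≅ A ⊞ B) → ExtZero A B := fun A B e => by
    by_contra h
    obtain ⟨E, hE, hlt⟩ := exists_finrank_end_lt h
    rw [← dv_biprod, ← dv_congr e, hX] at hE
    have h1 := Nat.find_min' hP ⟨E, hE, rfl⟩
    have h2 : Module.finrank k (A ⊞ B ⟶ A ⊞ B) = Module.finrank k (X ⟶ X) :=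
      (Linear.homCongr k e e).finrank_eq.symm
    omega
  refine ⟨X, ⟨fun h0 => ?_, fun A B e => ?_⟩, hX⟩
  · have h1 : dv X = 0 := funext fun i => by
      have := (Finset.sum_eq_zero_iff.1 (isZero_iff_tdim.1 h0)) i (Finset.mem_univ i)
      simp [dv, this]
    rw [← hX, h1] at hx1
    simp [eulerForm] at hx1
  · by_contra! hc
    have h1 := (key A B e).finrank_hom hQ.finite_arrows
    have h2 := (key B A (e ≪≫ biprod.braiding A B)).finrank_hom hQ.finite_arrows
    have h3 := hQ.eulerForm_pos (dv_ne_zero hc.1)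
    have h4 := hQ.eulerForm_pos (dv_ne_zero hc.2)
    rw [← hX, dv_congr e, dv_biprod] at hx1
    simp only [eulerForm_add_left, eulerForm_add_right] at hx1
    omega

end Existence

/-! ### Automorphisms of a direct sum of pairwise orthogonal bricks modulo the radical -/

section Units

variable {R S k : Type*} [Ring R] [Ring S]

/-- The elements `x` such that all `1 + g x` are invertible are closed under sums. -/
theorem isUnit_one_add_of_sum {σ : Type*} (A : Finset σ) (x : σ → R)
    (h : ∀ a ∈ A, ∀ g, IsUnit (1 + g * x a)) (g : R) : IsUnit (1 + g * ∑ a ∈ A, x a) := by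
  classical
  induction A using Finset.induction_on generalizing g with
  | empty => simp
  | insert a A ha ih =>
    obtain ⟨u, hu⟩ := h a (Finset.mem_insert_self _ _) g
    have h1 := ih (fun b hb => h b (Finset.mem_insert_of_mem hb)) (↑u⁻¹ * g)
    have h2 : 1 + g * ∑ b ∈ insert a A, x b = u * (1 + ↑u⁻¹ * g * ∑ b ∈ A, x b) := by
      rw [Finset.sum_insert ha, mul_add, ← add_assoc, ← hu, mul_add, mul_one, mul_assoc,
        Units.mul_inv_cancel_left]
    rw [h2]
    exact u.isUnit.mul h1

theorem isUnit_iff_of_ker (φ : R →+* S) (hs : Function.Surjective φ)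
    (hk : ∀ x, φ x = 0 → IsUnit (1 + x)) (f : R) : IsUnit f ↔ IsUnit (φ f) := by
  refine ⟨fun h => h.map φ, fun ⟨u, hu⟩ => ?_⟩
  obtain ⟨g, hg⟩ := hs ↑u⁻¹
  have h1 : IsUnit (f * g) := by
    have := hk (f * g - 1) (by rw [map_sub, map_mul, hg, ← hu, map_one, Units.mul_inv, sub_self])
    rwa [add_sub_cancel] at this
  have h2 : IsUnit (g * f) := by
    have := hk (g * f - 1) (by rw [map_sub, map_mul, hg, ← hu, map_one, Units.inv_mul, sub_self])
    rwa [add_sub_cancel] at this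
  obtain ⟨a, ha⟩ := h1.exists_right_inv
  obtain ⟨b, hb⟩ := h2.exists_left_inv
  exact isUnit_iff_exists_and_exists.2
    ⟨⟨g * a, by rw [← mul_assoc, ha]⟩, ⟨b * g, by rw [mul_assoc, hb]⟩⟩

/-- A surjection whose kernel consists of elements `x` with `1 + x` invertible detects units, so
that the units are a union of cosets of the kernel. -/
theorem card_units_eq [Field k] [Algebra k R] [Algebra k S] (φ : R →ₐ[k] S)
    (hs : Function.Surjective φ) (hk : ∀ x, φ x = 0 → IsUnit (1 + x)) :
    Nat.card Rˣ = Nat.card (LinearMap.ker φ.toLinearMap) * Nat.card Sˣ := by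
  obtain ⟨s, hs'⟩ := φ.toLinearMap.exists_rightInverse_of_surjective (LinearMap.range_eq_top.2 hs)
  have hs'' : ∀ y, φ (s y) = y := fun y => LinearMap.congr_fun hs' y
  have key : ∀ f : R, IsUnit f ↔ IsUnit (φ f) := isUnit_iff_of_ker φ.toRingHom hs hk
  have hφ : ∀ (x : LinearMap.ker φ.toLinearMap) (y : S), φ (x.1 + s y) = y := fun x y => by
    have hx : φ x.1 = 0 := x.2
    rw [map_add, hx, hs'', zero_add]
  rw [← Nat.card_prod]
  refine (Nat.card_congr (Equiv.ofBijective
    (fun p : LinearMap.ker φ.toLinearMap × Sˣ =>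
      ((key (p.1.1 + s p.2)).2 (by rw [hφ]; exact p.2.isUnit)).unit) ⟨?_, fun u => ?_⟩)).symm
  · rintro ⟨x, u⟩ ⟨y, v⟩ h
    have h1 : x.1 + s u = y.1 + s v := congrArg Units.val h
    have h2 : (u : S) = v := by rw [← hφ x u, h1, hφ]
    rw [h2] at h1
    exact Prod.ext (Subtype.ext (add_right_cancel h1)) (Units.ext h2)
  · refine ⟨⟨⟨u.1 - s (φ u.1), ?_⟩, Units.map φ.toRingHom.toMonoidHom u⟩, Units.ext ?_⟩
    · change φ (u.1 - s (φ u.1)) = 0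
      rw [map_sub, hs'', sub_self]
    · exact sub_add_cancel _ _

end Units

section OrthogonalBricks

variable {C : Type*} [Category C] [Preadditive C] {k : Type*} [Field k] [Linear k C]

/-- The scalar by which an endomorphism of an object with one-dimensional endomorphism algebra
acts. -/
def endScalar {Y : C} (h : Module.finrank k (Y ⟶ Y) = 1) : (Y ⟶ Y) ≃ₗ[k] k :=
  (LinearEquiv.ofBijective (LinearMap.toSpanSingleton k (Y ⟶ Y) (𝟙 Y)) (by
    have h0 : 𝟙 Y ≠ 0 := fun h0 => by
      have : Subsingleton (Y ⟶ Y) := ⟨fun f g => by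
        rw [← Category.comp_id f, ← Category.comp_id g, h0, comp_zero, comp_zero]⟩
      rw [Module.finrank_zero_of_subsingleton] at h
      exact zero_ne_one h
    constructor
    · rw [← LinearMap.ker_eq_bot]
      exact LinearMap.ker_toSpanSingleton k h0
    · exact (finrank_eq_one_iff_of_nonzero' _ h0).1 h)).symm

theorem endScalar_smul_id {Y : C} (h : Module.finrank k (Y ⟶ Y) = 1) (f : Y ⟶ Y) :
    endScalar h f • 𝟙 Y = f :=
  (endScalar h).symm_apply_apply f

theorem endScalar_id {Y : C} (h : Module.finrank k (Y ⟶ Y) = 1) : endScalar h (𝟙 Y) = 1 :=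
  (endScalar h).symm.injective (by
    rw [LinearEquiv.symm_apply_apply]
    exact (one_smul k (𝟙 Y)).symm)

theorem endScalar_comp {Y : C} (h : Module.finrank k (Y ⟶ Y) = 1) (f g : Y ⟶ Y) :
    endScalar h (f ≫ g) = endScalar h f * endScalar h g := by
  conv_lhs => rw [← endScalar_smul_id h f, Linear.smul_comp, Category.id_comp]
  rw [map_smul, smul_eq_mul]

variable [HasFiniteBiproducts C] {J : Type} [Fintype J] (X : J → C) (n : J → ℕ)

/-- The direct sum of `n j` copies of `X j` for all `j`. -/
abbrev isotypicSum : C := ⨁ fun p : (Σ j : J, Fin (n j)) => X p.1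

/-- The inclusion of a summand. -/
abbrev inc (p : Σ j : J, Fin (n j)) : X p.1 ⟶ isotypicSum X n :=
  biproduct.ι (fun p : (Σ j : J, Fin (n j)) => X p.1) p

/-- The projection to a summand. -/
abbrev prj (p : Σ j : J, Fin (n j)) : isotypicSum X n ⟶ X p.1 :=
  biproduct.π (fun p : (Σ j : J, Fin (n j)) => X p.1) p

theorem sum_prj_inc : ∑ p, prj X n p ≫ inc X n p = 𝟙 (isotypicSum X n) := biproduct.total

variable {X}

/-- The diagonal blocks of an endomorphism of `⨁ X_j^{n_j}`, as matrices over `k`; they form an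
algebra homomorphism because `X_j → X_l → X_j` vanishes for `j ≠ l`. -/
def diagBlocks (hend : ∀ j, Module.finrank k (X j ⟶ X j) = 1)
    (hzero : ∀ j l, j ≠ l → ∀ (f : X j ⟶ X l) (g : X l ⟶ X j), f ≫ g = 0) :
    End (isotypicSum X n) →ₐ[k] ∀ j, Matrix (Fin (n j)) (Fin (n j)) k :=
  AlgHom.ofLinearMap
    { toFun := fun f j a b => endScalar (hend j)
        (inc X n ⟨j, b⟩ ≫ f ≫ prj X n ⟨j, a⟩)
      map_add' := fun f g => by
        funext j a b
        change endScalar (hend j) (_ ≫ (f + g) ≫ _) = endScalar (hend j) _ + endScalar (hend j) _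
        rw [Preadditive.add_comp, Preadditive.comp_add, map_add]
      map_smul' := fun c f => by
        funext j a b
        change endScalar (hend j) (_ ≫ (c • f) ≫ _) = c • endScalar (hend j) _
        rw [Linear.smul_comp, Linear.comp_smul, map_smul] }
    (by
      classical
      funext j
      ext a b
      change endScalar (hend j) (inc X n ⟨j, b⟩ ≫
        𝟙 _ ≫ prj X n ⟨j, a⟩) = (1 : Matrix (Fin (n j)) (Fin (n j)) k) a b
      rw [Category.id_comp]
      by_cases hab : a = b
      · subst hab
        rw [biproduct.ι_π_self, endScalar_id, Matrix.one_apply_eq]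
      · rw [biproduct.ι_π_ne _ (by simpa using Ne.symm hab), map_zero, Matrix.one_apply_ne hab])
    (fun f g => by
      funext j
      ext a b
      change endScalar (hend j) (inc X n ⟨j, b⟩ ≫
        (g ≫ f) ≫ prj X n ⟨j, a⟩) =
        ∑ c : Fin (n j), endScalar (hend j) (inc X n ⟨j, c⟩ ≫ f ≫ prj X n ⟨j, a⟩) *
          endScalar (hend j) (inc X n ⟨j, b⟩ ≫ g ≫ prj X n ⟨j, c⟩)
      have h1 : inc X n ⟨j, b⟩ ≫
          (g ≫ f) ≫ prj X n ⟨j, a⟩ = ∑ p : (Σ j : J, Fin (n j)), (inc X n ⟨j, b⟩ ≫ g ≫ prj X n p) ≫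
            (inc X n p ≫ f ≫ prj X n ⟨j, a⟩) := by
        have h2 : g ≫ f = g ≫ (∑ p, prj X n p ≫ inc X n p) ≫ f := by
          rw [sum_prj_inc, Category.id_comp]
        rw [h2]
        simp only [Preadditive.sum_comp, Preadditive.comp_sum, Category.assoc]
      rw [h1, Fintype.sum_sigma, Finset.sum_eq_single j]
      · rw [map_sum]
        exact Finset.sum_congr rfl fun c _ => by rw [endScalar_comp, mul_comm]
      · intro l _ hl
        exact Finset.sum_eq_zero fun c _ => hzero j l hl.symm _ _
      · simp)

theorem diagBlocks_apply (hend : ∀ j, Module.finrank k (X j ⟶ X j) = 1)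
    (hzero : ∀ j l, j ≠ l → ∀ (f : X j ⟶ X l) (g : X l ⟶ X j), f ≫ g = 0)
    (f : End (isotypicSum X n)) (j : J) (a b : Fin (n j)) :
    diagBlocks n hend hzero f j a b = endScalar (hend j)
      (inc X n ⟨j, b⟩ ≫ f ≫ prj X n ⟨j, a⟩) :=
  rfl

theorem diagBlocks_surjective (hend : ∀ j, Module.finrank k (X j ⟶ X j) = 1)
    (hzero : ∀ j l, j ≠ l → ∀ (f : X j ⟶ X l) (g : X l ⟶ X j), f ≫ g = 0) :
    Function.Surjective (diagBlocks n hend hzero) := fun A => by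
  classical
  refine ⟨biproduct.matrix fun p q : (Σ j : J, Fin (n j)) =>
    if h : p.1 = q.1 then A q.1 q.2 (Fin.cast (congrArg n h) p.2) • eqToHom (congrArg X h)
    else 0, ?_⟩
  funext j
  ext a b
  rw [diagBlocks_apply, ← Category.assoc, biproduct.ι_matrix, biproduct.lift_π]
  simp [endScalar_id]

/-- An endomorphism all of whose diagonal blocks vanish lies in the radical: it is a sum of
endomorphisms that factor as `M → X_p → X_q → M` such that every composite `X_p → X_q → M → X_p`
vanishes. -/
theorem isUnit_one_add_of_diagBlocks_eq_zero (hend : ∀ j, Module.finrank k (X j ⟶ X j) = 1)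
    (hzero : ∀ j l, j ≠ l → ∀ (f : X j ⟶ X l) (g : X l ⟶ X j), f ≫ g = 0)
    (f : End (isotypicSum X n)) (hf : diagBlocks n hend hzero f = 0) : IsUnit (1 + f) := by
  let ι := inc X n
  let π := prj X n
  let x : (Σ j : J, Fin (n j)) × (Σ j : J, Fin (n j)) → End (isotypicSum X n) :=
    fun p => π p.1 ≫ (ι p.1 ≫ f ≫ π p.2) ≫ ι p.2
  have hx : f = ∑ p, x p := by
    have h1 : f = (∑ p, π p ≫ ι p) ≫ f ≫ (∑ p, π p ≫ ι p) := by
      rw [sum_prj_inc, Category.id_comp]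
      exact (Category.comp_id f).symm
    rw [Fintype.sum_prod_type, Finset.sum_comm]
    conv_lhs => rw [h1]
    simp only [Preadditive.sum_comp, Preadditive.comp_sum, Category.assoc, x]
  have h := isUnit_one_add_of_sum Finset.univ x (fun p _ g => ?_) 1
  · rwa [one_mul, ← hx] at h
  · refine IsNilpotent.isUnit_one_add ⟨2, ?_⟩
    have h0 : (ι p.1 ≫ f ≫ π p.2) ≫ (ι p.2 ≫ g ≫ π p.1) = 0 := by
      obtain ⟨⟨j, b⟩, ⟨l, a⟩⟩ := p
      by_cases hjl : j = l
      · subst hjl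
        have h1 : ι ⟨j, b⟩ ≫ f ≫ π ⟨j, a⟩ = 0 := (endScalar (hend j)).injective (by
          rw [← diagBlocks_apply n hend hzero, hf, map_zero]; rfl)
        exact (congrArg (· ≫ _) h1).trans zero_comp
      · exact hzero j l hjl _ _
    have h2 : (x p ≫ g) ≫ (x p ≫ g) = 0 := by
      have h3 : (x p ≫ g) ≫ (x p ≫ g) = π p.1 ≫ ((ι p.1 ≫ f ≫ π p.2) ≫ (ι p.2 ≫ g ≫ π p.1)) ≫
          (ι p.1 ≫ f ≫ π p.2) ≫ ι p.2 ≫ g := by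
        simp only [x, Category.assoc]
      rw [h3, h0, zero_comp, comp_zero]
    rw [pow_two]
    exact h2

theorem finrank_end_isotypicSum [∀ Y Z : C, Module.Finite k (Y ⟶ Z)] :
    Module.finrank k (End (isotypicSum X n)) =
      ∑ j, ∑ l, n j * n l * Module.finrank k (X j ⟶ X l) := by
  let e : (isotypicSum X n ⟶ isotypicSum X n) ≃ₗ[k]
      ∀ p q : (Σ j : J, Fin (n j)), (X p.1 ⟶ X q.1) :=
    { biproduct.matrixEquiv with
      map_add' := fun f g => by
        funext p q
        simp [biproduct.matrixEquiv, biproduct.components]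
      map_smul' := fun c f => by
        funext p q
        simp [biproduct.matrixEquiv, biproduct.components] }
  refine e.finrank_eq.trans ?_
  have h : ∀ d : J → J → ℕ, ∑ p : (Σ j : J, Fin (n j)), ∑ q : (Σ j : J, Fin (n j)), d p.1 q.1 =
      ∑ j, ∑ l, n j * n l * d j l := fun d => by
    simp [Fintype.sum_sigma, Finset.mul_sum, mul_assoc]
  rw [← h]
  simp only [Module.finrank_pi_fintype]

/-- The number of automorphisms of `⨁ X_j^{n_j}`. -/
theorem card_aut_isotypicSum [Finite k] [∀ Y Z : C, Module.Finite k (Y ⟶ Z)]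
    (hend : ∀ j, Module.finrank k (X j ⟶ X j) = 1)
    (hzero : ∀ j l, j ≠ l → ∀ (f : X j ⟶ X l) (g : X l ⟶ X j), f ≫ g = 0) :
    (Nat.card (Aut (isotypicSum X n)) : ℝ) =
      (Nat.card k : ℝ) ^ ((∑ j, ∑ l, (n j : ℤ) * n l * Module.finrank k (X j ⟶ X l)) -
          ∑ j, (n j : ℤ) ^ 2) *
        ∏ j, ∏ i ∈ Finset.range (n j), ((Nat.card k : ℝ) ^ n j - (Nat.card k : ℝ) ^ i) := by
  have := Fintype.ofFinite k
  set φ := diagBlocks n hend hzero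
  have hφ : Function.Surjective φ := diagBlocks_surjective n hend hzero
  have hfin : Module.Finite k (End (isotypicSum X n)) :=
    inferInstanceAs (Module.Finite k (isotypicSum X n ⟶ isotypicSum X n))
  have h1 := LinearMap.finrank_range_add_finrank_ker φ.toLinearMap
  have h2 : Module.finrank k (LinearMap.range φ.toLinearMap) = ∑ j, n j ^ 2 := by
    rw [LinearMap.range_eq_top.2 hφ, finrank_top, Module.finrank_pi_fintype]
    simp [Module.finrank_matrix, pow_two]
  rw [h2, finrank_end_isotypicSum] at h1
  have h3 : (∑ j, ∑ l, (n j : ℤ) * n l * Module.finrank k (X j ⟶ X l)) - ∑ j, (n j : ℤ) ^ 2 =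
      (Module.finrank k (LinearMap.ker φ.toLinearMap) : ℤ) := by
    zify at h1
    linarith
  have h4 : Nat.card (∀ j, Matrix (Fin (n j)) (Fin (n j)) k)ˣ =
      ∏ j, Nat.card (GL (Fin (n j)) k) := by
    rw [Nat.card_congr MulEquiv.piUnits.toEquiv, Nat.card_pi]
  rw [← Nat.card_congr (Aut.unitsEndEquivAut (isotypicSum X n)).toEquiv,
    card_units_eq φ hφ (isUnit_one_add_of_diagBlocks_eq_zero n hend hzero), h3, h4, zpow_natCast,
    Module.natCard_eq_pow_finrank (K := k)]
  push_cast
  congr 1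
  refine Finset.prod_congr rfl fun j _ => ?_
  rw [Matrix.card_GL_field, Finset.prod_range, ← Nat.card_eq_fintype_card]
  push_cast
  refine Finset.prod_congr rfl fun i _ => ?_
  rw [Nat.cast_sub (Nat.pow_le_pow_right Nat.card_pos i.2.le)]
  push_cast
  rfl

end OrthogonalBricks

/-! ### Automorphism polynomials -/

section AutPoly

variable {I : Type} [Fintype I] [DecidableEq I] [Quiver.{0} I]

open LaurentPolynomial

theorem isIndecOfDim_indecRep (hQ : IsDynkin I) (k : Type) [Field k] (β : PosRoot I) :
    IsIndecOfDim k β.1 (indecRep k β) := by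
  obtain ⟨X, hX, hd⟩ := exists_indecomposable (k := k) hQ β.2.2 (hQ.eulerForm_root β.2.1)
  exact Classical.epsilon_spec (p := IsIndecOfDim k β.1) ⟨X, hX, fun i => congrFun hd i⟩

theorem indecomposable_indecRep (hQ : IsDynkin I) (k : Type) [Field k] (β : PosRoot I) :
    Indecomposable (indecRep k β) :=
  (isIndecOfDim_indecRep hQ k β).1

theorem dv_indecRep (hQ : IsDynkin I) (k : Type) [Field k] (β : PosRoot I) :
    dv (indecRep k β) = β.1 :=
  funext fun i => (isIndecOfDim_indecRep hQ k β).2 i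

theorem finrank_end_indecRep (hQ : IsDynkin I) (k : Type) [Field k] (β : PosRoot I) :
    Module.finrank k (indecRep k β ⟶ indecRep k β) = 1 := by
  have h := finrank_end_of_indecomposable hQ (indecomposable_indecRep hQ k β)
  rw [dv_indecRep hQ, hQ.eulerForm_root β.2.1] at h
  exact_mod_cast h

theorem indecRep_comp_eq_zero (hQ : IsDynkin I) (k : Type) [Field k] {β γ : PosRoot I}
    (h : β ≠ γ) (f : indecRep k β ⟶ indecRep k γ) (g : indecRep k γ ⟶ indecRep k β) :
    f ≫ g = 0 := by
  by_contra h0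
  have := (isBrick_of_indecomposable hQ (indecomposable_indecRep hQ k β)).isIso _ h0
  have := (indecomposable_indecRep hQ k γ).isIso_of_retract f (g ≫ inv (f ≫ g))
    (by rw [← Category.assoc, IsIso.hom_inv_id]) (indecomposable_indecRep hQ k β).1
  exact h (Subtype.ext (by rw [← dv_indecRep hQ k β, ← dv_indecRep hQ k γ, dv_congr (asIso f)]))

/-- The dimension of the radical of `End(M_q(lam))`, which does not depend on `q`. -/
def radDim (lam : RootFun I) : ℤ :=
  (∑ β ∈ lam.support, ∑ γ ∈ lam.support, (lam β : ℤ) * lam γ * max 0 (eulerForm I β.1 γ.1)) -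
    ∑ β ∈ lam.support, (lam β : ℤ) ^ 2

/-- The explicit form of the automorphism polynomial: the radical of `End(M_q(lam))` contributes
a power of `v`, and its semisimple quotient the orders of the groups `GL_{lam(β)}(𝔽_q)`. -/
def autPolyForm (lam : RootFun I) : LaurentPolynomial ℤ :=
  T (2 * radDim lam) *
    ∏ β ∈ lam.support, ∏ i ∈ Finset.range (lam β), (T (2 * (lam β : ℤ)) - T (2 * (i : ℤ)))

theorem evalAt_T {S : Type*} [CommRing S] (x : Sˣ) (n : ℤ) : evalAt x (T n) = ↑(x ^ n) := by
  simp [evalAt]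

theorem evalAt_sqrtCard_T (k : Type) [Field k] [Finite k] (n : ℤ) :
    evalAt (sqrtCard k) (T (2 * n)) = (Nat.card k : ℝ) ^ n := by
  rw [evalAt_T, zpow_mul, Units.val_zpow_eq_zpow_val]
  congr 1
  exact (zpow_ofNat _ 2).trans (Real.sq_sqrt (Nat.cast_nonneg _))

theorem isAutPoly_autPolyForm (hQ : IsDynkin I) (lam : RootFun I) :
    IsAutPoly lam (autPolyForm lam) := by
  intro k _ _
  have h := card_aut_isotypicSum (k := k) (X := fun β : lam.support => indecRep k β.1)
    (fun β => lam β.1) (fun β => finrank_end_indecRep hQ k β.1)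
    (fun β γ h => indecRep_comp_eq_zero hQ k fun h' => h (Subtype.ext h'))
  refine h.trans ?_
  rw [autPolyForm, map_mul, evalAt_sqrtCard_T, map_prod, ← Finset.prod_coe_sort lam.support]
  congr 1
  · congr 1
    rw [radDim, ← Finset.sum_coe_sort lam.support, ← Finset.sum_coe_sort lam.support]
    congr 1
    refine Finset.sum_congr rfl fun β _ => ?_
    rw [← Finset.sum_coe_sort lam.support]
    refine Finset.sum_congr rfl fun γ _ => ?_
    rw [finrank_hom_of_indecomposable hQ (indecomposable_indecRep hQ k _)
      (indecomposable_indecRep hQ k _), dv_indecRep hQ, dv_indecRep hQ]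
  · refine Finset.prod_congr rfl fun β _ => ?_
    rw [map_prod]
    refine Finset.prod_congr rfl fun i _ => ?_
    rw [map_sub, evalAt_sqrtCard_T, evalAt_sqrtCard_T, zpow_natCast, zpow_natCast]

/-- A Laurent polynomial is determined by its values at `√q`, for the prime numbers `q`. -/
theorem laurentPolynomial_ext {a b : LaurentPolynomial ℤ}
    (h : ∀ (k : Type) [Field k] [Finite k], evalAt (sqrtCard k) a = evalAt (sqrtCard k) b) :
    a = b := by
  obtain ⟨n, p, hp⟩ := LaurentPolynomial.exists_T_pow (a - b)
  have hp0 : p = 0 := by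
    have h1 : p.map (Int.castRingHom ℝ) = 0 := by
      refine Polynomial.eq_zero_of_infinite_isRoot _ ((Set.infinite_range_of_injective
        (f := fun q : Nat.Primes => Real.sqrt (q : ℕ)) fun q q' hqq => ?_).mono ?_)
      · have := (Real.sqrt_inj (Nat.cast_nonneg _) (Nat.cast_nonneg _)).1 hqq
        exact Nat.Primes.coe_nat_injective (by exact_mod_cast this)
      · rintro _ ⟨q, rfl⟩
        have := Fact.mk q.2
        have h2 : evalAt (sqrtCard (ZMod q)) (Polynomial.toLaurent p) = 0 := by
          rw [hp, map_mul, map_sub, h, sub_self, zero_mul]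
        have h3 : evalAt (sqrtCard (ZMod q)) (Polynomial.toLaurent p) =
            p.eval₂ (Int.castRingHom ℝ) (Real.sqrt (q : ℕ)) := by
          rw [evalAt, LaurentPolynomial.eval₂_toLaurent]
          congr 1
          exact congrArg (fun m : ℕ => Real.sqrt m) (Nat.card_zmod q)
        change Polynomial.IsRoot _ _
        rw [Polynomial.IsRoot, Polynomial.eval_map, ← h3, h2]
    exact (Polynomial.map_injective _ (Int.castRingHom ℝ).injective_int) (by
      rw [h1, Polynomial.map_zero])
  rw [hp0, map_zero] at hp
  exact sub_eq_zero.1 (((isUnit_T (R := ℤ) n).mul_left_eq_zero).1 hp.symm)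

theorem autPoly_eq (hQ : IsDynkin I) (lam : RootFun I) : autPoly lam = autPolyForm lam := by
  have h : ∃ a, IsAutPoly lam a := ⟨_, isAutPoly_autPolyForm hQ lam⟩
  rw [autPoly, dif_pos h]
  exact laurentPolynomial_ext fun k _ _ =>
    (h.choose_spec k).symm.trans (isAutPoly_autPolyForm hQ lam k)

theorem substSq_T (n : ℤ) : substSq (T n) = T (2 * n) := by
  let φ : Multiplicative ℤ →* LaurentPolynomial ℤ := AddMonoidAlgebra.of ℤ ℤ
  have hu : (isUnit_T (R := ℤ) 2).unit = φ.toHomUnits (Multiplicative.ofAdd 2) := Units.ext rfl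
  rw [substSq, evalAt_T, hu, ← map_zpow, MonoidHom.coe_toHomUnits, ← ofAdd_zsmul, smul_eq_mul,
    mul_comm]
  rfl

/-- The factors `v^{4n} - v^{4i}` of `|GL_n|` at `v²` are the factors with even index of
`|GL_{2n}|` at `v`. -/
theorem substSq_autPolyForm_dvd (lam : RootFun I) :
    substSq (autPolyForm lam) ∣ autPolyForm (2 • lam) := by
  have hs : (2 • lam).support = lam.support := Finsupp.support_smul_eq two_ne_zero
  rw [autPolyForm, autPolyForm, map_mul, substSq_T, map_prod, hs]
  refine mul_dvd_mul ((isUnit_T _).dvd) (Finset.prod_dvd_prod_of_dvd _ _ fun β _ => ?_)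
  rw [map_prod]
  have h1 : ∏ i ∈ Finset.range (lam β), substSq (T (2 * (lam β : ℤ)) - T (2 * (i : ℤ))) =
      ∏ i ∈ (Finset.range (lam β)).image fun i : ℕ => 2 * i,
        (T (2 * (((2 • lam) β : ℕ) : ℤ)) - T (2 * ((i : ℕ) : ℤ)) : LaurentPolynomial ℤ) := by
    rw [Finset.prod_image fun i _ j _ h => Nat.eq_of_mul_eq_mul_left two_pos h]
    refine Finset.prod_congr rfl fun i _ => ?_
    rw [map_sub, substSq_T, substSq_T, Finsupp.smul_apply]
    push_cast
    rfl
  rw [h1]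
  refine Finset.prod_dvd_prod_of_subset _ _ _ fun i hi => ?_
  simp only [Finset.mem_image, Finset.mem_range, Finsupp.smul_apply, smul_eq_mul] at hi ⊢
  omega

theorem substSq_autPoly_dvd (hQ : IsDynkin I) (lam : RootFun I) :
    substSq (autPoly lam) ∣ autPoly (2 • lam) := by
  rw [autPoly_eq hQ, autPoly_eq hQ]
  exact substSq_autPolyForm_dvd lam

end AutPoly

/-! ### Integrality of the values of the character -/

section Integrality

open LaurentPolynomial

theorem vHalf_zpow_mem (n : ℤ) : vHalf ^ n ∈ ZZv := by
  have h1 : vHalf ∈ ZZv := Algebra.subset_adjoin (by simp)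
  have h2 : vHalf⁻¹ ∈ ZZv := Algebra.subset_adjoin (by simp)
  cases n with
  | ofNat n => simpa using pow_mem h1 n
  | negSucc n => simpa [zpow_negSucc, ← inv_pow] using pow_mem h2 (n + 1)

theorem vv_zpow_mem (n : ℤ) : vv ^ n ∈ ZZv := by
  have : vv ^ n = vHalf ^ (2 * n) := by rw [zpow_mul]; rfl
  rw [this]
  exact vHalf_zpow_mem _

theorem evalAt_vUnit_mem (a : LaurentPolynomial ℤ) : evalAt vUnit a ∈ ZZv := by
  induction a using LaurentPolynomial.induction_on' with
  | add p q hp hq => rw [map_add]; exact add_mem hp hq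
  | C_mul_T n r =>
    rw [map_mul, evalAt_T, Units.val_zpow_eq_zpow_val]
    refine mul_mem ?_ (vv_zpow_mem n)
    have : evalAt vUnit (C r) = (r : Kv) := by simp [evalAt]
    rw [this]
    exact intCast_mem _ _

variable {I : Type} [Fintype I] [DecidableEq I] [Quiver.{0} I]

theorem vv_zpow_injective : Function.Injective fun n : ℤ => vv ^ n := by
  have h0 : vv ≠ 0 := vUnit.ne_zero
  have key : ∀ n : ℕ, vv ^ n = 1 → n = 0 := fun n h => by
    have h1 : (algebraMap (Polynomial ℚ) Kv) (Polynomial.X ^ (2 * n)) =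
        algebraMap (Polynomial ℚ) Kv (Polynomial.X ^ 0) := by
      rw [pow_zero, map_one, map_pow, RatFunc.algebraMap_X, pow_mul]
      exact h
    have h2 := congrArg Polynomial.natDegree (RatFunc.algebraMap_injective ℚ h1)
    rw [Polynomial.natDegree_X_pow, Polynomial.natDegree_X_pow] at h2
    omega
  intro m n h
  have h1 : vv ^ (m - n) = 1 := by
    rw [zpow_sub₀ h0]
    exact (div_eq_one_iff_eq (zpow_ne_zero n h0)).2 h
  rcases Int.eq_nat_or_neg (m - n) with ⟨j, hj | hj⟩
  · rw [hj, zpow_natCast] at h1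
    have := key j h1
    omega
  · rw [hj, zpow_neg, inv_eq_one, zpow_natCast] at h1
    have := key j h1
    omega

/-- The denominators in the definition of `χ` do not vanish. -/
theorem evalAt_substSq_autPolyForm_ne_zero (lam : RootFun I) :
    evalAt vUnit (substSq (autPolyForm lam)) ≠ 0 := by
  have hT : ∀ n : ℤ, evalAt vUnit (substSq (T n)) = vv ^ (2 * n) := fun n => by
    rw [substSq_T, evalAt_T, Units.val_zpow_eq_zpow_val]
    rfl
  rw [autPolyForm]
  simp only [map_mul, map_prod, map_sub, hT]
  refine mul_ne_zero (zpow_ne_zero _ vUnit.ne_zero) (Finset.prod_ne_zero_iff.2 fun β _ =>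
    Finset.prod_ne_zero_iff.2 fun i hi => sub_ne_zero.2 fun h => ?_)
  have := vv_zpow_injective h
  rw [Finset.mem_range] at hi
  omega

theorem chiU_mem (hQ : IsDynkin I) (rho : QuiverInvolution I) (k : Type) [Field k]
    (lam : RootFun I) : chiU rho k lam ∈ ZZv := by
  unfold chiU
  split_ifs
  · refine mul_mem (mul_mem (mul_mem (vHalf_zpow_mem _) ?_) ?_) (evalAt_vUnit_mem _)
    · exact_mod_cast vv_zpow_mem (2 * homSum k (lamF rho lam) (lamC rho lam) : ℕ)
    · obtain ⟨c, hc⟩ := substSq_autPoly_dvd hQ (lamF rho lam)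
      rw [hc, map_mul, mul_div_cancel_left₀ _ ?_]
      · exact evalAt_vUnit_mem c
      · rw [autPoly_eq hQ]
        exact evalAt_substSq_autPolyForm_ne_zero _
  · exact zero_mem _

theorem chi_mem (hQ : IsDynkin I) (rho : QuiverInvolution I) (k : Type) [Field k]
    {x : BTilde I} (hx : x ∈ integralForm I) : chi rho k x ∈ ZZv := by
  induction hx using Submodule.span_induction with
  | mem x h =>
    obtain ⟨α, mu, rfl⟩ := h
    rw [Ku, map_smul, smul_eq_mul, uK, chi, Finsupp.linearCombination_single, one_smul]
    exact mul_mem (vv_zpow_mem _) (mul_mem (chiU_mem hQ rho k mu) (vv_zpow_mem _))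
  | zero => rw [map_zero]; exact zero_mem _
  | add x y _ _ hx hy => rw [map_add]; exact add_mem hx hy
  | smul c x _ hx =>
    have h1 : chi rho k (c • x) = (c : Kv) * chi rho k x := by
      rw [← smul_eq_mul, ← map_smul]; rfl
    rw [h1]
    exact mul_mem c.2 hx

end Integrality

end IHall
end

theorem lemma5p1 {I : Type} [Fintype I] [DecidableEq I] [Quiver.{0} I] (hQ : IHall.IsDynkin I)
    (rho : IHall.QuiverInvolution I) (k : Type) [Field k] [Finite k] :
    (∀ lam : IHall.RootFun I,
      IHall.substSq (IHall.autPoly lam) ∣ IHall.autPoly (2 • lam)) ∧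
    (∀ x ∈ IHall.integralForm I, IHall.chi rho k x ∈ IHall.ZZv) :=
  ⟨IHall.substSq_autPoly_dvd hQ, fun _ hx => IHall.chi_mem hQ rho k hx⟩
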